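/- Let $D\ge 1$, let $X=\mathbb{R}^D$ with the Euclidean norm, let $\mathcal{M}$ be the set of real $D\times D$ matrices $M$ with largest singular value $\sigma_{\max}(M)=1$, and let $\lambda,B>0$. Let $\mathcal{H}$ be a class of $\lambda$-Lipschitz functions $h:X\to[0,1]$. For a probability distribution $\mathcal{D}$ on $X\times\{0,1\}$, a sample $S_m=((x_1,y_1),\dots,(x_m,y_m))$, a matrix $M\in\mathcal{M}$ and $\gamma>0$ put $$\mathrm{err}(M,\mathcal{D}):=\inf_{h\in\mathcal{H}}\ \Pr_{(x,y)\sim\mathcal{D}}\big[\,|h(Mx)-y|\ge 1/2\,\big],\qquad \mathrm{err}^{\gamma}(M,S_m):=\inf_{h\in\mathcal{H}}\ \frac1m\,\big|\{\,i : \mathrm{Margin}(h(Mx_i),y_i)<\gamma\,\}\big|,$$ where $\mathrm{Margin}(\hat y,y)=\hat y-1/2$ if $y=1$ and $\mathrm{Margin}(\hat y,y)=1/2-\hat y$ if $y=0$. The fat-shattering dimension $\mathrm{fat}_{\alpha}(\mathcal{H})$ is the supremum of the sizes of the finite sets $S\subset X$ for which there is $r:S\to\mathbb{R}$ such that for every $T\subseteq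 S$ some $h\in\mathcal{H}$ satisfies $h(x)\ge r(x)+\alpha$ for all $x\in T$ and $h(x)\le r(x)-\alpha$ for all $x\in S\setminus T$. There is a universal constant $C>0$ (independent of $D,\lambda,B,\mathcal{H},\gamma,m,\delta,\mathcal{D}$) such that the following holds. Let $0<\gamma<1/2$, $0<\delta<1$, and let $m$ be an integer with $m\ge \mathrm{fat}_{\gamma/16}(\mathcal{H})\ge 1$. Let $\mathcal{D}$ be a probability distribution on $X\times\{0,1\}$ with $\|x\|\le B$ almost surely. Then, with probability at least $1-\delta$ over an i.i.d. sample $S_m$ of size $m$ from $\mathcal{D}$, $$\sup_{M\in\mathcal{M}}\big[\mathrm{err}(M,\mathcal{D})-\mathrm{err}^{\gamma}(M,S_m)\big]\ \le\ C\,\sqrt{\frac1m\ln\frac1\delta+\frac{D^2}{m}\ln\frac{D}{\epsilon_0}+\frac{\mathrm{fat}_{\gamma/16}(\mathcal{H})}{m}\ln\Big(\frac m\gamma\Big)},\qquad \epsilon_0:=\min\Big\{\frac{\gamma}{2},\frac{1}{2\lambda B}\Big\}.$$ -/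

import Mathlib

open MeasureTheory
open scoped NNReal ENNReal

noncomputable section

/-- The representation space `ℝ^D` with the Euclidean norm. -/
abbrev RepSpace (D : ℕ) : Type := EuclideanSpace ℝ (Fin D)

/-- A labelled observation `(x, y)` with `x ∈ ℝ^D` and `y ∈ {0, 1}`. -/
abbrev LabelledObs (D : ℕ) : Type := RepSpace D × Fin 2

/-- The label `y ∈ {0, 1}` as a real number. -/
def labelVal (y : Fin 2) : ℝ := ((y : ℕ) : ℝ)

/-- The largest singular value of a real square matrix: its operator norm with respect to the
Euclidean norm. -/
def sigmaMax {D : ℕ} (M : Matrix (Fin D) (Fin D) ℝ) : ℝ :=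
  ‖Matrix.toEuclideanCLM (n := Fin D) (𝕜 := ℝ) M‖

/-- The class of weighting metrics: real `D × D` matrices with `σ_max(M) = 1`. -/
def weightingMetrics (D : ℕ) : Set (Matrix (Fin D) (Fin D) ℝ) :=
  {M | sigmaMax M = 1}

/-- The vector `M x`. -/
def applyMetric {D : ℕ} (M : Matrix (Fin D) (Fin D) ℝ) (x : RepSpace D) : RepSpace D :=
  Matrix.toEuclideanCLM (n := Fin D) (𝕜 := ℝ) M x

/-- The margin of the prediction `yhat` at the label `y`: `yhat - 1/2` if `y = 1`, and
`1/2 - yhat` otherwise. -/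
def margin (yhat : ℝ) (y : Fin 2) : ℝ :=
  if y = 1 then yhat - 1 / 2 else 1 / 2 - yhat

/-- The classifier-based error of the metric `M` under the distribution `μ`:
the infimum over `h ∈ H` of the probability that `|h(Mx) - y| ≥ 1/2`. -/
def classifierError {D : ℕ} (H : Set (RepSpace D → ℝ)) (M : Matrix (Fin D) (Fin D) ℝ)
    (μ : Measure (LabelledObs D)) : ℝ :=
  ⨅ h : H, μ.real {z | 1 / 2 ≤ |h.1 (applyMetric M z.1) - labelVal z.2|}

open Classical in
/-- The empirical classifier-based error of `M` at margin `γ` on the sample `S`: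
the infimum over `h ∈ H` of the fraction of indices `i` with `margin (h(M x_i)) y_i < γ`. -/
def empiricalMarginError {D m : ℕ} (H : Set (RepSpace D → ℝ)) (γ : ℝ)
    (M : Matrix (Fin D) (Fin D) ℝ) (S : Fin m → LabelledObs D) : ℝ :=
  ⨅ h : H, (1 / (m : ℝ)) *
    ∑ i : Fin m, if margin (h.1 (applyMetric M (S i).1)) (S i).2 < γ then (1 : ℝ) else 0

/-- The finite set `S` is `γ`-shattered by the class `H`: for some real witnesses `r x` (`x ∈ S`),
each subset `T` of `S` is realized by an `h ∈ H` with `h x ≥ r x + γ` on `T` and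
`h x ≤ r x - γ` on `S \ T`. -/
def FatShatters {X : Type*} (γ : ℝ) (H : Set (X → ℝ)) (S : Finset X) : Prop :=
  ∃ r : X → ℝ, ∀ T ⊆ S, ∃ h ∈ H, ∀ x ∈ S,
    (x ∈ T → r x + γ ≤ h x) ∧ (x ∉ T → h x ≤ r x - γ)

/-- The fat-shattering dimension of `H` at margin `γ`: the supremum (possibly `∞`) of the
cardinalities of the finite sets that are `γ`-shattered by `H`. -/
def fatDim {X : Type*} (γ : ℝ) (H : Set (X → ℝ)) : ℕ∞ :=
  ⨆ (S : Finset X) (_ : FatShatters γ H S), (S.card : ℕ∞)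

end

/-! For one fixed metric this is a margin bound for the functions `margin (h (M x)) y`, comparing a
low threshold for the true probability with a high one for the sample. A grid of N = (2K+1)^(D²)
matrices and a union bound at confidence δ/N make it uniform in M. By the Lipschitz property,
replacing M by a grid matrix moves margins by at most γ/16 on the ball of radius B; passing to a
countable net of H, needed for measurability, costs another γ/16. The thresholds γ/4 and 3γ/4 leave
room for both between 0 and γ.

The delicate point is the single logarithm next to the fat-shattering dimension d: the packing bound
available for a sup-norm net on 2m points has log-size of order d log² m. Choose r with log₂ m ≤ 4^r
≤ 8 log(m/γ). After symmetrization by random swaps, margins on the double sample are quantized to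
the levels 0, …, 5 and approximated in two steps. A coarse net, accurate to one level off a fraction
4^(-r) of the points, has log-size O(d 4^r). A fine net, accurate everywhere, has log-size O(d
4^(2r)), but the correction from coarse to fine lives on a fraction 4^(-r) of the points.
Hoeffding's exponent for it therefore gains a factor 4^r, which pays for the larger net
(`card_bad_swaps_le`).

Both net sizes rest on `card_le_card_shatteredCubes_pow`: a separated class splits at some
coordinate and level into two large parts, the numbers of cubes shattered by the parts add up, and
induction bounds the class by a power of its number of shattered cubes. Such cubes have at most d
coordinates, so they can be counted. For the coarse net, a random choice of few coordinates first
removes the dependence on m. -/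

section Cubes

/-! ### Separated classes and the cubes they shatter -/

variable {I : Type*}

/-- A cube assigns to some of the coordinates a level `k`; it is shattered by `F` if each choice
of sides (`≤ k` or `≥ k + 2`) on its coordinates is realized in `F`. -/
def ShattersCube {b : ℕ} (F : Finset (I → ℕ)) (c : I → Option (Fin b)) : Prop :=
  ∀ T : Set I, ∃ f ∈ F, ∀ i k, c i = some k →
    (i ∈ T → (k : ℕ) + 2 ≤ f i) ∧ (i ∉ T → f i ≤ k)

theorem ShattersCube.mono {b : ℕ} {F G : Finset (I → ℕ)} (h : F ⊆ G) {c : I → Option (Fin b)}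
    (hc : ShattersCube F c) : ShattersCube G c := fun T => by
  obtain ⟨f, hf, h'⟩ := hc T
  exact ⟨f, h hf, h'⟩

variable [Fintype I]

/-- Two integer-valued functions are separated at the coordinates where they differ by at
least `2`. -/
def sepCoords (f g : I → ℕ) : Finset I :=
  Finset.univ.filter fun i => f i + 2 ≤ g i ∨ g i + 2 ≤ f i

theorem sepCoords_comm (f g : I → ℕ) : sepCoords f g = sepCoords g f := by
  ext i; simp [sepCoords, or_comm]

theorem sepCoords_self (f : I → ℕ) : sepCoords f f = ∅ := by
  ext i; simp [sepCoords]

open Classical in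
/-- The cubes shattered by `F`. -/
noncomputable def shatteredCubes (b : ℕ) (F : Finset (I → ℕ)) : Finset (I → Option (Fin b)) :=
  Finset.univ.filter fun c => ShattersCube F c

theorem mem_shatteredCubes {b : ℕ} {F : Finset (I → ℕ)} {c : I → Option (Fin b)} :
    c ∈ shatteredCubes b F ↔ ShattersCube F c := by
  classical
  simp [shatteredCubes]

open Classical in
-- A cube shattered by both halves cannot involve `i`. Adding `i` at level `k` to it gives a new
-- cube, shattered by `F` but by neither half, which makes up for the cube having been counted
-- twice.
theorem card_shatteredCubes_add_le {b : ℕ} (F : Finset (I → ℕ)) (i : I) (k : Fin b) :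
    (shatteredCubes b (F.filter fun f => (k : ℕ) + 2 ≤ f i)).card +
      (shatteredCubes b (F.filter fun f => f i ≤ (k : ℕ))).card ≤ (shatteredCubes b F).card := by
  set U := shatteredCubes b (F.filter fun f => (k : ℕ) + 2 ≤ f i) with hU
  set V := shatteredCubes b (F.filter fun f => f i ≤ (k : ℕ)) with hV
  have hnone : ∀ c ∈ U ∩ V, c i = none := by
    intro c hc
    rw [Finset.mem_inter, hU, hV, mem_shatteredCubes, mem_shatteredCubes] at hc
    by_contra hne
    obtain ⟨l, hl⟩ := Option.ne_none_iff_exists'.1 hne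
    obtain ⟨f, hf, hf'⟩ := hc.1 ∅
    obtain ⟨g, hg, hg'⟩ := hc.2 Set.univ
    have h1 := (hf' i l hl).2 (by simp)
    have h2 := (hg' i l hl).1 (by simp)
    have h3 := (Finset.mem_filter.1 hf).2
    have h4 := (Finset.mem_filter.1 hg).2
    omega
  set ext : (I → Option (Fin b)) → (I → Option (Fin b)) := fun c => Function.update c i (some k)
    with hext
  have hinj : Set.InjOn ext (U ∩ V : Finset _) := by
    intro c hc c' hc' h
    funext j
    by_cases hj : j = i
    · subst hj
      rw [hnone c hc, hnone c' hc']
    · have := congrFun h j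
      simpa [hext, hj] using this
  have hdisj : Disjoint (U ∪ V) ((U ∩ V).image ext) := by
    rw [Finset.disjoint_left]
    intro c hc hc'
    obtain ⟨c', -, rfl⟩ := Finset.mem_image.1 hc'
    have hi : ext c' i = some k := by simp [hext]
    rw [Finset.mem_union, hU, hV, mem_shatteredCubes, mem_shatteredCubes] at hc
    rcases hc with hc | hc
    · obtain ⟨f, hf, hf'⟩ := hc ∅
      have h1 := (hf' i k hi).2 (by simp)
      have h3 := (Finset.mem_filter.1 hf).2
      omega
    · obtain ⟨f, hf, hf'⟩ := hc Set.univ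
      have h1 := (hf' i k hi).1 (by simp)
      have h3 := (Finset.mem_filter.1 hf).2
      omega
  have hsub : (U ∪ V) ∪ (U ∩ V).image ext ⊆ shatteredCubes b F := by
    intro c hc
    rw [mem_shatteredCubes]
    rcases Finset.mem_union.1 hc with hc | hc
    · rcases Finset.mem_union.1 hc with hc | hc
      · exact (mem_shatteredCubes.1 hc).mono (Finset.filter_subset _ _)
      · exact (mem_shatteredCubes.1 hc).mono (Finset.filter_subset _ _)
    · obtain ⟨c', hc', rfl⟩ := Finset.mem_image.1 hc
      have hn := hnone c' hc'
      rw [Finset.mem_inter, hU, hV, mem_shatteredCubes, mem_shatteredCubes] at hc'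
      intro T
      by_cases hT : i ∈ T
      · obtain ⟨f, hf, hf'⟩ := hc'.1 T
        refine ⟨f, (Finset.mem_filter.1 hf).1, fun j l hjl => ?_⟩
        by_cases hj : j = i
        · subst hj
          have : k = l := by simpa [hext] using hjl
          subst this
          exact ⟨fun _ => (Finset.mem_filter.1 hf).2, fun h => absurd hT h⟩
        · exact hf' j l (by simpa [hext, hj] using hjl)
      · obtain ⟨f, hf, hf'⟩ := hc'.2 T
        refine ⟨f, (Finset.mem_filter.1 hf).1, fun j l hjl => ?_⟩
        by_cases hj : j = i
        · subst hj
          have : k = l := by simpa [hext] using hjl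
          subst this
          exact ⟨fun h => absurd h hT, fun _ => (Finset.mem_filter.1 hf).2⟩
        · exact hf' j l (by simpa [hext, hj] using hjl)
  calc U.card + V.card = (U ∪ V).card + (U ∩ V).card := (Finset.card_union_add_card_inter U V).symm
    _ = (U ∪ V).card + ((U ∩ V).image ext).card := by rw [Finset.card_image_of_injOn hinj]
    _ = ((U ∪ V) ∪ (U ∩ V).image ext).card := (Finset.card_union_of_disjoint hdisj).symm
    _ ≤ _ := Finset.card_le_card hsub

open Classical in
/-- If the members of `F` are pairwise separated on many coordinates, then some level at some
coordinate splits `F` into two large parts. -/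
theorem exists_splitting_level {b q : ℕ} (F : Finset (I → ℕ)) (hb : ∀ f ∈ F, ∀ i, f i ≤ b + 1)
    (hq : 0 < q) (hsep : ∀ f ∈ F, ∀ g ∈ F, f ≠ g → q ≤ (sepCoords f g).card) (hF : 2 ≤ F.card) :
    ∃ (i : I) (k : Fin b), q * F.card ^ 2 ≤ 4 * Fintype.card I * b *
      ((F.filter fun f => (k : ℕ) + 2 ≤ f i).card * (F.filter fun f => f i ≤ (k : ℕ)).card) := by
  by_contra! hcon
  set P : I → Fin b → ℕ := fun i k =>
    (F.filter fun f => (k : ℕ) + 2 ≤ f i).card * (F.filter fun f => f i ≤ (k : ℕ)).card with hP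
  have hPe : ∀ i k, P i k = ∑ f ∈ F, ∑ g ∈ F,
      if (k : ℕ) + 2 ≤ f i ∧ g i ≤ k then 1 else 0 := by
    intro i k
    simp only [hP, Finset.card_filter, Finset.sum_mul_sum]
    refine Finset.sum_congr rfl fun f _ => Finset.sum_congr rfl fun g _ => ?_
    split_ifs <;> simp_all
  have hpair : ∀ f ∈ F, ∀ g ∈ F, (sepCoords f g).card ≤
      (∑ i, ∑ k : Fin b, if (k : ℕ) + 2 ≤ f i ∧ g i ≤ k then 1 else 0) +
      ∑ i, ∑ k : Fin b, if (k : ℕ) + 2 ≤ g i ∧ f i ≤ k then 1 else 0 := by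
    intro f hf g hg
    rw [sepCoords, Finset.card_filter, ← Finset.sum_add_distrib]
    refine Finset.sum_le_sum fun i _ => ?_
    split_ifs with h
    · rcases h with h | h
      -- The lower of the two values serves as separating level; it is below `b` because the other
      -- value is at most `b + 1`.
      · have hlt : f i < b := by have := hb g hg i; omega
        refine le_trans ?_ (Nat.le_add_left _ _)
        refine le_trans ?_ (Finset.single_le_sum (f := fun k : Fin b =>
          if (k : ℕ) + 2 ≤ g i ∧ f i ≤ k then 1 else 0) (fun _ _ => Nat.zero_le _)
          (Finset.mem_univ (⟨f i, hlt⟩ : Fin b)))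
        simp [h]
      · have hlt : g i < b := by have := hb f hf i; omega
        refine le_trans ?_ (Nat.le_add_right _ _)
        refine le_trans ?_ (Finset.single_le_sum (f := fun k : Fin b =>
          if (k : ℕ) + 2 ≤ f i ∧ g i ≤ k then 1 else 0) (fun _ _ => Nat.zero_le _)
          (Finset.mem_univ (⟨g i, hlt⟩ : Fin b)))
        simp [h]
    · exact Nat.zero_le _
  -- Double counting: `P i k` counts the ordered pairs that level `k` separates at `i`, and each
  -- pair of distinct members is separated at `q` or more coordinates.
  have htot : q * (F.card * (F.card - 1)) ≤ 2 * ∑ i, ∑ k, P i k := by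
    have e1 : q * (F.card * (F.card - 1)) = ∑ _x ∈ F.offDiag, q := by
      rw [Finset.sum_const, Finset.offDiag_card, smul_eq_mul, Nat.mul_sub_one, mul_comm]
    have swap : ∀ A : (I → ℕ) → (I → ℕ) → I → Fin b → ℕ,
        ∑ f ∈ F, ∑ g ∈ F, ∑ i, ∑ k, A f g i k = ∑ i, ∑ k, ∑ f ∈ F, ∑ g ∈ F, A f g i k := by
      intro A
      calc _ = ∑ f ∈ F, ∑ i, ∑ k, ∑ g ∈ F, A f g i k := by
            refine Finset.sum_congr rfl fun f _ => ?_
            rw [Finset.sum_comm]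
            exact Finset.sum_congr rfl fun i _ => Finset.sum_comm
        _ = _ := by
            rw [Finset.sum_comm]
            exact Finset.sum_congr rfl fun i _ => Finset.sum_comm
    calc q * (F.card * (F.card - 1)) = ∑ _x ∈ F.offDiag, q := e1
      _ ≤ ∑ x ∈ F.offDiag, (sepCoords x.1 x.2).card := by
          refine Finset.sum_le_sum fun x hx => ?_
          rw [Finset.mem_offDiag] at hx
          exact hsep _ hx.1 _ hx.2.1 hx.2.2
      _ ≤ ∑ x ∈ F ×ˢ F, (sepCoords x.1 x.2).card :=
          Finset.sum_le_sum_of_subset (fun x hx => by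
            rw [Finset.mem_offDiag] at hx; exact Finset.mem_product.2 ⟨hx.1, hx.2.1⟩)
      _ = ∑ f ∈ F, ∑ g ∈ F, (sepCoords f g).card := Finset.sum_product _ _ _
      _ ≤ ∑ f ∈ F, ∑ g ∈ F, ((∑ i, ∑ k : Fin b, if (k : ℕ) + 2 ≤ f i ∧ g i ≤ k then 1 else 0) +
            ∑ i, ∑ k : Fin b, if (k : ℕ) + 2 ≤ g i ∧ f i ≤ k then 1 else 0) :=
          Finset.sum_le_sum fun f hf => Finset.sum_le_sum fun g hg => hpair f hf g hg
      _ = 2 * ∑ i, ∑ k, P i k := by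
          simp only [Finset.sum_add_distrib]
          rw [swap, swap, two_mul]
          congr 1
          · exact Finset.sum_congr rfl fun i _ => Finset.sum_congr rfl fun k _ => (hPe i k).symm
          · refine Finset.sum_congr rfl fun i _ => Finset.sum_congr rfl fun k _ => ?_
            rw [hPe, Finset.sum_comm]
  have hsq : F.card ^ 2 ≤ 2 * (F.card * (F.card - 1)) := by
    obtain ⟨n, hn⟩ := Nat.exists_eq_add_of_le hF
    rw [hn, show 2 + n - 1 = n + 1 by omega]
    nlinarith
  have hpos : 0 < q * F.card ^ 2 := by positivity
  have hlow : q * F.card ^ 2 ≤ 4 * ∑ i, ∑ k, P i k := by nlinarith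
  have hne : 0 < ∑ i, ∑ k, P i k := by omega
  obtain ⟨i0, -, hi0⟩ := Finset.exists_ne_zero_of_sum_ne_zero hne.ne'
  obtain ⟨k0, -, -⟩ := Finset.exists_ne_zero_of_sum_ne_zero hi0
  have hlt : ∑ i, ∑ k, 4 * Fintype.card I * b * P i k < ∑ _i : I, ∑ _k : Fin b, q * F.card ^ 2 := by
    refine Finset.sum_lt_sum_of_nonempty ⟨i0, Finset.mem_univ _⟩ fun i _ => ?_
    exact Finset.sum_lt_sum_of_nonempty ⟨k0, Finset.mem_univ _⟩ fun k _ => hcon i k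
  simp only [← Finset.mul_sum, Finset.sum_const, Finset.card_univ, Fintype.card_fin,
    smul_eq_mul] at hlt
  have : Fintype.card I * b * (q * F.card ^ 2) ≤ Fintype.card I * b * (4 * ∑ i, ∑ k, P i k) :=
    Nat.mul_le_mul_left _ hlow
  nlinarith

/-- A class whose members are pairwise separated on at least `q` coordinates has at most
polynomially many members in the number of cubes it shatters. -/
theorem card_le_card_shatteredCubes_pow {b q p : ℕ} (hq : 0 < q)
    (hp : 4 * Fintype.card I * b ≤ q * 4 ^ p) (F : Finset (I → ℕ))
    (hb : ∀ f ∈ F, ∀ i, f i ≤ b + 1)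
    (hsep : ∀ f ∈ F, ∀ g ∈ F, f ≠ g → q ≤ (sepCoords f g).card) :
    F.card ≤ (shatteredCubes b F).card ^ p := by
  classical
  induction hn : F.card using Nat.strong_induction_on generalizing F with
  | _ n ih =>
  subst hn
  rcases Nat.lt_or_ge F.card 2 with h2 | h2
  · rcases F.eq_empty_or_nonempty with rfl | ⟨f, hf⟩
    · simp
    · have : 0 < (shatteredCubes b F).card :=
        Finset.card_pos.2 ⟨fun _ => none, mem_shatteredCubes.2 fun T => ⟨f, hf, by simp⟩⟩
      have := Nat.one_le_pow p _ this
      omega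
  · obtain ⟨i, k, hik⟩ := exists_splitting_level F hb hq hsep h2
    have hsum := card_shatteredCubes_add_le F i k
    set U := F.filter fun f => (k : ℕ) + 2 ≤ f i with hU
    set V := F.filter fun f => f i ≤ (k : ℕ) with hV
    have hUV : U.card + V.card ≤ F.card := by
      rw [← Finset.card_union_of_disjoint]
      · exact Finset.card_le_card (Finset.union_subset (Finset.filter_subset _ _)
          (Finset.filter_subset _ _))
      · rw [Finset.disjoint_left]
        intro f h1 h2
        have := (Finset.mem_filter.1 h1).2
        have := (Finset.mem_filter.1 h2).2
        omega
    have hmain : F.card ^ 2 ≤ 4 ^ p * (U.card * V.card) := by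
      refine Nat.le_of_mul_le_mul_left ?_ hq
      calc q * F.card ^ 2 ≤ 4 * Fintype.card I * b * (U.card * V.card) := hik
        _ ≤ q * 4 ^ p * (U.card * V.card) := Nat.mul_le_mul_right _ hp
        _ = _ := by ring
    have hpos : 0 < U.card * V.card := by
      rcases Nat.eq_zero_or_pos (U.card * V.card) with h | h
      · rw [h, mul_zero] at hmain
        nlinarith
      · exact h
    have hU0 : 0 < U.card := Nat.pos_of_mul_pos_right hpos
    have hV0 : 0 < V.card := Nat.pos_of_mul_pos_left hpos
    have hUb := ih U.card (by omega) U (fun f hf => hb f (Finset.mem_filter.1 hf).1)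
      (fun f hf g hg => hsep f (Finset.mem_filter.1 hf).1 g (Finset.mem_filter.1 hg).1) rfl
    have hVb := ih V.card (by omega) V (fun f hf => hb f (Finset.mem_filter.1 hf).1)
      (fun f hf g hg => hsep f (Finset.mem_filter.1 hf).1 g (Finset.mem_filter.1 hg).1) rfl
    set x := (shatteredCubes b U).card
    set y := (shatteredCubes b V).card
    have hfin : F.card ^ 2 ≤ ((x + y) ^ p) ^ 2 := by
      calc F.card ^ 2 ≤ 4 ^ p * (U.card * V.card) := hmain
        _ ≤ 4 ^ p * (x ^ p * y ^ p) := by gcongr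
        _ = (4 * (x * y)) ^ p := by rw [mul_pow, mul_pow]
        -- The inequality 4xy ≤ (x + y)² absorbs the factor 4^p lost in the splitting.
        _ ≤ ((x + y) ^ 2) ^ p := by
            refine Nat.pow_le_pow_left ?_ p
            zify
            nlinarith [sq_nonneg ((x : ℤ) - y)]
        _ = _ := by rw [← pow_mul, ← pow_mul, mul_comm]
    exact (Nat.pow_le_pow_iff_left (by norm_num)).1 hfin |>.trans (Nat.pow_le_pow_left hsum p)

end Cubes

/-! ### Counting cubes, and extracting few coordinates at random -/

section Counting

variable {I : Type*} [Fintype I]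

/-- The number of cubes with at most `d` coordinates. -/
theorem card_cubes_le {b d : ℕ} (hb : 1 ≤ b) (hd : 1 ≤ d) (hdI : d ≤ Fintype.card I)
    (A : Finset (I → Option (Fin b)))
    (hA : ∀ c ∈ A, (Finset.univ.filter fun i => (c i).isSome).card ≤ d) :
    (A.card : ℝ) ≤ (Real.exp 1 * b * Fintype.card I / d) ^ d := by
  classical
  set n := Fintype.card I with hn
  have hn0 : (0 : ℝ) < n := by exact_mod_cast (by omega : 0 < n)
  have hd0 : (0 : ℝ) < d := by exact_mod_cast (by omega : 0 < d)
  have hb0 : (0 : ℝ) < b := by exact_mod_cast (by omega : 0 < b)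
  -- Weight each used coordinate by x; this value makes (1 + bx)^n at most e^d.
  set x : ℝ := d / (b * n) with hx
  have hx0 : 0 < x := by positivity
  have hx1 : x ≤ 1 := by
    rw [hx, div_le_one (by positivity)]
    have h1 : (d : ℝ) ≤ n := by exact_mod_cast hdI
    have h2 : (1 : ℝ) ≤ b := by exact_mod_cast hb
    nlinarith
  have hgen : ∑ c : I → Option (Fin b), ∏ i, (if (c i).isSome then x else 1) = (1 + b * x) ^ n := by
    have := Finset.prod_univ_sum (fun _ : I => (Finset.univ : Finset (Option (Fin b))))
      (fun _ o => if o.isSome then x else (1 : ℝ))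
    rw [Fintype.piFinset_univ] at this
    rw [← this]
    simp [Fintype.sum_option, hn]
  have hlow : (A.card : ℝ) * x ^ d ≤ ∑ c : I → Option (Fin b), ∏ i, (if (c i).isSome then x else 1) := by
    calc (A.card : ℝ) * x ^ d = ∑ _c ∈ A, x ^ d := by simp
      _ ≤ ∑ c ∈ A, ∏ i, (if (c i).isSome then x else 1) := by
          refine Finset.sum_le_sum fun c hc => ?_
          rw [Finset.prod_ite, Finset.prod_const, Finset.prod_const_one, mul_one]
          exact pow_le_pow_of_le_one hx0.le hx1 (hA c hc)
      _ ≤ _ := Finset.sum_le_sum_of_subset_of_nonneg (Finset.subset_univ _)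
          fun c _ _ => Finset.prod_nonneg fun i _ => by split_ifs <;> positivity
  rw [hgen] at hlow
  have hexp : (1 + b * x) ^ n ≤ Real.exp 1 ^ d := by
    calc (1 + b * x) ^ n ≤ Real.exp (b * x) ^ n := by
          refine pow_le_pow_left₀ (by positivity) ?_ n
          linarith [Real.add_one_le_exp (b * x)]
      _ = Real.exp 1 ^ d := by
          rw [← Real.exp_nat_mul, ← Real.exp_nat_mul]
          congr 1
          rw [hx]; field_simp
  have hxd : 0 < x ^ d := by positivity
  have : (A.card : ℝ) ≤ Real.exp 1 ^ d / x ^ d := by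
    rw [le_div_iff₀ hxd]; exact hlow.trans hexp
  refine this.trans (le_of_eq ?_)
  rw [← div_pow, hx]
  congr 1
  field_simp

open Classical in
/-- A set of density at least `1/ℓ` is hit at least `u` times by most sequences of length
`4 ℓ u`. -/
theorem card_sequences_few_hits_le (E : Finset I) {l u : ℕ}
    (hE : Fintype.card I ≤ l * E.card) (hI : 0 < Fintype.card I) :
    ((Finset.univ.filter fun w : Fin (4 * l * u) → I =>
        (Finset.univ.filter fun j => w j ∈ E).card < u).card : ℝ) ≤
      Real.exp (-u) * (Fintype.card I : ℝ) ^ (4 * l * u) := by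
  set n := Fintype.card I with hn
  set s := 4 * l * u with hs
  have hn0 : (0 : ℝ) < n := by exact_mod_cast hI
  have hl0 : (0 : ℝ) < l := by
    have : l ≠ 0 := by rintro rfl; omega
    exact_mod_cast Nat.pos_of_ne_zero this
  have hgen : ∑ w : Fin s → I, ∏ j, (if w j ∈ E then Real.exp (-1) else 1) =
      ((n : ℝ) - E.card * (1 - Real.exp (-1))) ^ s := by
    have := Finset.prod_univ_sum (fun _ : Fin s => (Finset.univ : Finset I))
      (fun _ i => if i ∈ E then Real.exp (-1) else (1 : ℝ))
    rw [Fintype.piFinset_univ] at this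
    rw [← this, Finset.prod_const, Finset.card_univ, Fintype.card_fin]
    congr 1
    have : ∀ i, (if i ∈ E then Real.exp (-1) else (1 : ℝ)) =
        1 - (if i ∈ E then 1 else 0) * (1 - Real.exp (-1)) := fun i => by split_ifs <;> ring
    simp only [this, Finset.sum_sub_distrib, ← Finset.sum_mul]
    simp [hn]
  set A := Finset.univ.filter fun w : Fin s → I => (Finset.univ.filter fun j => w j ∈ E).card < u
  have hlow : (A.card : ℝ) * Real.exp (-u) ≤
      ∑ w : Fin s → I, ∏ j, (if w j ∈ E then Real.exp (-1) else 1) := by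
    calc (A.card : ℝ) * Real.exp (-u) = ∑ _w ∈ A, Real.exp (-u) := by simp
      _ ≤ ∑ w ∈ A, ∏ j, (if w j ∈ E then Real.exp (-1) else 1) := by
          refine Finset.sum_le_sum fun w hw => ?_
          rw [Finset.prod_ite, Finset.prod_const, Finset.prod_const_one, mul_one,
            ← Real.exp_nat_mul, Real.exp_le_exp]
          have : ((Finset.univ.filter fun j => w j ∈ E).card : ℝ) ≤ u := by
            exact_mod_cast (Finset.mem_filter.1 hw).2.le
          linarith
      _ ≤ _ := Finset.sum_le_sum_of_subset_of_nonneg (Finset.subset_univ _)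
          fun c _ _ => Finset.prod_nonneg fun i _ => by split_ifs <;> positivity
  rw [hgen] at hlow
  have hhalf : Real.exp (-1) ≤ 1 / 2 := by
    rw [Real.exp_neg, one_div]
    have := Real.add_one_le_exp (1 : ℝ)
    gcongr
    linarith
  have hEl : (n : ℝ) / l ≤ E.card := by
    rw [div_le_iff₀ hl0]
    have : (n : ℝ) ≤ l * E.card := by exact_mod_cast hE
    linarith
  have hEn : (E.card : ℝ) ≤ n := by exact_mod_cast Finset.card_le_univ E
  -- Over 4ℓu draws these factors give exp(-2u); Markov's inequality for exp(-hits) gives back only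
  -- exp(u).
  have hbase : (n : ℝ) - E.card * (1 - Real.exp (-1)) ≤ n * Real.exp (-(1 / (2 * l))) := by
    have h1 := Real.add_one_le_exp (-(1 / (2 * (l : ℝ))))
    have h2 : (n : ℝ) * (-(1 / (2 * l)) + 1) ≤ n * Real.exp (-(1 / (2 * l))) := by gcongr
    have h3 : (n : ℝ) * (1 / (2 * l)) = n / l / 2 := by field_simp
    have h4 : (0 : ℝ) ≤ E.card := by positivity
    nlinarith
  have hpow : ((n : ℝ) - E.card * (1 - Real.exp (-1))) ^ s ≤ n ^ s * Real.exp (-(2 * u)) := by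
    have h0 : 0 ≤ (n : ℝ) - E.card * (1 - Real.exp (-1)) := by
      have := Real.exp_pos (-1)
      have h4 : (0 : ℝ) ≤ E.card := by positivity
      nlinarith
    calc _ ≤ ((n : ℝ) * Real.exp (-(1 / (2 * l)))) ^ s := pow_le_pow_left₀ h0 hbase s
      _ = _ := by
          rw [mul_pow, ← Real.exp_nat_mul]
          congr 2
          rw [hs]; push_cast; field_simp; ring
  have hfin : (A.card : ℝ) * Real.exp (-u) ≤ (Real.exp (-u) * n ^ s) * Real.exp (-u) := by
    refine (hlow.trans hpow).trans (le_of_eq ?_)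
    rw [show -(2 * (u : ℝ)) = -u + -u by ring, Real.exp_add]; ring
  exact le_of_mul_le_mul_right hfin (Real.exp_pos _)

open Classical in
/-- A small class whose members are pairwise separated on a fraction `1/ℓ` of the coordinates
stays separated on a short sequence of coordinates. -/
theorem exists_separating_sequence {l v : ℕ} (F : Finset (I → ℕ)) (hF : F.card ≤ 2 ^ v)
    (hv : 0 < v) (hI : 0 < Fintype.card I)
    (hsep : ∀ f ∈ F, ∀ g ∈ F, f ≠ g → Fintype.card I ≤ l * (sepCoords f g).card) :
    ∃ w : Fin (4 * l * (2 * v)) → I, ∀ f ∈ F, ∀ g ∈ F, f ≠ g →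
      2 * v ≤ (sepCoords (f ∘ w) (g ∘ w)).card := by
  by_contra! hcon
  set s := 4 * l * (2 * v) with hs
  set n := Fintype.card I with hn
  set bad : (I → ℕ) × (I → ℕ) → Finset (Fin s → I) := fun x =>
    Finset.univ.filter fun w => (Finset.univ.filter fun j => w j ∈ sepCoords x.1 x.2).card < 2 * v
  have hcover : (Finset.univ : Finset (Fin s → I)) ⊆ F.offDiag.biUnion bad := by
    intro w _
    obtain ⟨f, hf, g, hg, hne, hlt⟩ := hcon w
    refine Finset.mem_biUnion.2 ⟨(f, g), Finset.mem_offDiag.2 ⟨hf, hg, hne⟩, ?_⟩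
    refine Finset.mem_filter.2 ⟨Finset.mem_univ _, ?_⟩
    have : (Finset.univ.filter fun j => w j ∈ sepCoords f g) = sepCoords (f ∘ w) (g ∘ w) := by
      ext j; simp [sepCoords]
    rwa [this]
  have h1 : (n : ℝ) ^ s ≤ ∑ x ∈ F.offDiag, ((bad x).card : ℝ) := by
    have := (Finset.card_le_card hcover).trans Finset.card_biUnion_le
    rw [Finset.card_univ, Fintype.card_fun, Fintype.card_fin] at this
    exact_mod_cast this
  have h2 : ∑ x ∈ F.offDiag, ((bad x).card : ℝ) ≤
      F.offDiag.card * (Real.exp (-(2 * v : ℕ)) * (n : ℝ) ^ s) := by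
    rw [← nsmul_eq_mul]
    refine Finset.sum_le_card_nsmul _ _ _ fun x hx => ?_
    rw [Finset.mem_offDiag] at hx
    exact card_sequences_few_hits_le _ (hsep _ hx.1 _ hx.2.1 hx.2.2) hI
  have h3 : (F.offDiag.card : ℝ) ≤ 2 ^ v * 2 ^ v := by
    have : F.offDiag.card ≤ 2 ^ v * 2 ^ v := by
      rw [Finset.offDiag_card]
      exact (Nat.sub_le _ _).trans (Nat.mul_le_mul hF hF)
    exact_mod_cast this
  -- The union bound over at most 4^v pairs succeeds because 4 < e².
  have h4 : (2 : ℝ) ^ v * 2 ^ v * Real.exp (-(2 * v : ℕ)) < 1 := by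
    have e : Real.exp (-(2 * v : ℕ)) = (Real.exp (-1) * Real.exp (-1)) ^ v := by
      rw [← Real.exp_add, ← Real.exp_nat_mul]; congr 1; push_cast; ring
    rw [e, ← mul_pow, ← mul_pow]
    refine pow_lt_one₀ (by positivity) ?_ hv.ne'
    have h5 : 2 * Real.exp (-1) < 1 := by
      have := Real.exp_one_gt_d9
      rw [Real.exp_neg]
      rw [mul_inv_lt_iff₀ (by positivity)]
      linarith
    have := Real.exp_pos (-1)
    nlinarith
  have hns : (0 : ℝ) < (n : ℝ) ^ s := by
    have : (0 : ℝ) < n := by exact_mod_cast hI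
    positivity
  have h5 : (n : ℝ) ^ s ≤ (2 ^ v * 2 ^ v * Real.exp (-(2 * v : ℕ))) * n ^ s := by
    refine (h1.trans h2).trans ?_
    rw [← mul_assoc]
    gcongr
  nlinarith

end Counting

/-! ### Fat-shattering along families of points -/

section Dimension

theorem FatShatters.mono {X : Type*} {α : ℝ} {G H : Set (X → ℝ)} (h : G ⊆ H) {S : Finset X}
    (hS : FatShatters α G S) : FatShatters α H S := by
  obtain ⟨r, hr⟩ := hS
  refine ⟨r, fun T hT => ?_⟩
  obtain ⟨f, hf, hf'⟩ := hr T hT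
  exact ⟨f, h hf, hf'⟩

/-- If a family of points `w j` is shattered, then the points are distinct, and they form a
shattered set. -/
theorem card_le_of_shattered_family {J X : Type*} {α : ℝ} (hα : 0 < α) {H : Set (X → ℝ)} {d : ℕ}
    (hdim : ∀ S : Finset X, FatShatters α H S → S.card ≤ d) (w : J → X) (A : Finset J)
    (r : J → ℝ)
    (hA : ∀ T : Set J, ∃ h ∈ H, ∀ j ∈ A,
      (j ∈ T → r j + α ≤ h (w j)) ∧ (j ∉ T → h (w j) ≤ r j - α)) :
    A.card ≤ d := by
  classical
  have hinj : Set.InjOn w A := by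
    intro j hj j' hj' h
    by_contra hne
    -- The two singleton patterns make contradictory demands at a repeated point.
    obtain ⟨f, -, hf⟩ := hA {j}
    obtain ⟨g, -, hg⟩ := hA {j'}
    have h1 := (hf j hj).1 rfl
    have h2 := (hf j' hj').2 (fun h => hne h.symm)
    have h3 := (hg j' hj').1 rfl
    have h4 := (hg j hj).2 hne
    rw [h] at h1 h4
    linarith
  rw [← Finset.card_image_of_injOn hinj]
  apply hdim
  rcases isEmpty_or_nonempty J with hJ | hJ
  · refine ⟨fun _ => 0, fun T _ => ?_⟩
    obtain ⟨h, hh, -⟩ := hA ∅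
    refine ⟨h, hh, fun x hx => ?_⟩
    obtain ⟨j, -, -⟩ := Finset.mem_image.1 hx
    exact (hJ.false j).elim
  · refine ⟨fun x => r (Function.invFunOn w A x), fun T _ => ?_⟩
    obtain ⟨h, hh, hh'⟩ := hA {j | w j ∈ T}
    refine ⟨h, hh, fun x hx => ?_⟩
    obtain ⟨j, hj, rfl⟩ := Finset.mem_image.1 hx
    have := hinj.leftInvOn_invFunOn hj
    simp only [this]
    exact hh' j hj

/-- An integer-valued class, seen as a class of real functions. -/
def realClass {I : Type*} (F : Finset (I → ℕ)) : Set (I → ℝ) :=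
  (fun f i => (f i : ℝ)) '' (F : Set (I → ℕ))

open Classical in
-- A level `k` yields the witness `k + 1`, at distance 1 from both sides of the cube. The sequence
-- `w` may repeat points, but not on the support of a shattered cube, so nothing is lost by sampling
-- with repetition.
theorem card_support_le_of_shattersCube {I J : Type*} [Fintype J] {b d : ℕ} {F : Finset (I → ℕ)}
    (hdim : ∀ S : Finset I, FatShatters 1 (realClass F) S → S.card ≤ d) (w : J → I)
    {c : J → Option (Fin b)} (hc : ShattersCube (F.image fun f => f ∘ w) c) :
    (Finset.univ.filter fun j => (c j).isSome).card ≤ d := by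
  refine card_le_of_shattered_family one_pos hdim w _
    (fun j => ((c j).elim 0 (fun k => (k : ℕ)) : ℕ) + 1) fun T => ?_
  obtain ⟨f', hf', hT⟩ := hc T
  obtain ⟨f, hf, rfl⟩ := Finset.mem_image.1 hf'
  refine ⟨fun i => f i, ⟨f, hf, rfl⟩, fun j hj => ?_⟩
  obtain ⟨k, hk⟩ := Option.isSome_iff_exists.1 (Finset.mem_filter.1 hj).2
  have := hT j k hk
  simp only [hk, Option.elim]
  refine ⟨fun h => ?_, fun h => ?_⟩
  · have h1 : (((k : ℕ) + 2 : ℕ) : ℝ) ≤ (f (w j) : ℕ) := by exact_mod_cast this.1 h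
    push_cast at h1
    linarith
  · have h1 : (f (w j) : ℝ) ≤ ((k : ℕ) : ℝ) := by exact_mod_cast this.2 h
    linarith

theorem realClass_mono {I : Type*} {F G : Finset (I → ℕ)} (h : F ⊆ G) :
    realClass F ⊆ realClass G :=
  Set.image_mono (by exact_mod_cast h)

end Dimension

/-! ### Packing bounds for separated integer-valued classes -/

section Packing

variable {I : Type*} [Fintype I] {d : ℕ}

/-- A class of dimension `d` whose members are pairwise separated somewhere has at most
quasi-polynomially many members. -/
theorem card_le_of_separated {l : ℕ} (hl : 1 ≤ l) (hd : 1 ≤ d) (F : Finset (I → ℕ))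
    (hb : ∀ f ∈ F, ∀ i, f i ≤ 5)
    (hdim : ∀ S : Finset I, FatShatters 1 (realClass F) S → S.card ≤ d)
    (hdI : d ≤ Fintype.card I) (hI : Fintype.card I ≤ 2 ^ (l + 1))
    (hsep : ∀ f ∈ F, ∀ g ∈ F, f ≠ g → 1 ≤ (sepCoords f g).card) :
    F.card ≤ 2 ^ (18 * l ^ 2 * d) := by
  classical
  have h1 := card_le_card_shatteredCubes_pow (b := 4) (q := 1) (p := 3 * l) one_pos
    (by
      calc 4 * Fintype.card I * 4 ≤ 4 * 2 ^ (l + 1) * 4 := by gcongr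
        _ = 2 ^ (l + 5) := by ring
        _ ≤ 2 ^ (2 * (3 * l)) := Nat.pow_le_pow_right (by norm_num) (by omega)
        _ = 1 * 4 ^ (3 * l) := by rw [pow_mul]; norm_num) F hb hsep
  have h2 := card_cubes_le (b := 4) (by norm_num) hd hdI (shatteredCubes 4 F) fun c hc => by
    refine card_support_le_of_shattersCube hdim id ?_
    simpa using mem_shatteredCubes.1 hc
  have h3 : ((shatteredCubes 4 F).card : ℝ) ≤ ((2 ^ (6 * l * d) : ℕ) : ℝ) := by
    refine h2.trans ?_
    push_cast
    rw [pow_mul (2 : ℝ)]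
    refine pow_le_pow_left₀ (by positivity) ?_ d
    have hd' : (1 : ℝ) ≤ d := by exact_mod_cast hd
    have hI' : (Fintype.card I : ℝ) ≤ 2 ^ (l + 1) := by exact_mod_cast hI
    have he : Real.exp 1 ≤ 4 := by linarith [Real.exp_one_lt_d9]
    calc Real.exp 1 * 4 * Fintype.card I / d ≤ Real.exp 1 * 4 * Fintype.card I :=
          div_le_self (by positivity) hd'
      _ ≤ 4 * 4 * 2 ^ (l + 1) := by gcongr
      _ = 2 ^ (l + 5) := by ring
      _ ≤ 2 ^ (6 * l) := pow_le_pow_right₀ (by norm_num) (by omega)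
  have h4 : (shatteredCubes 4 F).card ≤ 2 ^ (6 * l * d) := by exact_mod_cast h3
  calc F.card ≤ _ := h1
    _ ≤ (2 ^ (6 * l * d)) ^ (3 * l) := Nat.pow_le_pow_left h4 _
    _ = _ := by rw [← pow_mul]; congr 1; ring

/-- The comparison of exponents behind the constant 64 in `card_lt_of_separated_fraction`. -/
theorem quadratic_lt_pow_four (r : ℕ) : (13 + 4 * r) * (r + 3) < 64 * 4 ^ r := by
  induction r with
  | zero => norm_num
  | succ r ih =>
    rw [pow_succ]
    nlinarith

/-- A class of dimension `d` whose members are pairwise separated on a fraction `4 ^ (-r)` of the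
coordinates has a cardinality bounded independently of the number of coordinates. -/
theorem card_lt_of_separated_fraction {r : ℕ} (hd : 1 ≤ d) (F : Finset (I → ℕ))
    (hb : ∀ f ∈ F, ∀ i, f i ≤ 5)
    (hdim : ∀ S : Finset I, FatShatters 1 (realClass F) S → S.card ≤ d)
    (hI : 0 < Fintype.card I)
    (hsep : ∀ f ∈ F, ∀ g ∈ F, f ≠ g → Fintype.card I ≤ 4 ^ r * (sepCoords f g).card) :
    F.card < 2 ^ (64 * d * 4 ^ r) := by
  classical
  by_contra! hcon
  set v := 64 * d * 4 ^ r with hv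
  have hv0 : 0 < v := by positivity
  obtain ⟨G, hGF, hG⟩ := Finset.exists_subset_card_eq hcon
  obtain ⟨w, hw⟩ := exists_separating_sequence G hG.le hv0 hI
    fun f hf g hg => hsep f (hGF hf) g (hGF hg)
  have hinj : Set.InjOn (fun f : I → ℕ => f ∘ w) (G : Set (I → ℕ)) := by
    intro f hf g hg h
    by_contra hne
    have := hw f hf g hg hne
    have h' : f ∘ w = g ∘ w := h
    rw [h', sepCoords_self, Finset.card_empty] at this
    omega
  -- The extracted sequence has length 4 · 4^r · 2v and its separation is 2v, so their ratio, and
  -- hence the exponent r + 3, no longer involves the size of `I`.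
  have h1 := card_le_card_shatteredCubes_pow (b := 4) (q := 2 * v) (p := r + 3) (by omega)
    (by rw [Fintype.card_fin]; exact le_of_eq (by ring)) (G.image fun f => f ∘ w)
    (by
      intro f' hf' i
      obtain ⟨f, hf, rfl⟩ := Finset.mem_image.1 hf'
      exact hb f (hGF hf) _)
    (by
      intro f' hf' g' hg' hne
      obtain ⟨f, hf, rfl⟩ := Finset.mem_image.1 hf'
      obtain ⟨g, hg, rfl⟩ := Finset.mem_image.1 hg'
      exact hw f hf g hg (fun h => hne (by rw [h])))
  rw [Finset.card_image_of_injOn hinj, hG] at h1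
  have hdv : d ≤ v := by
    rw [hv]
    have : 1 ≤ 4 ^ r := Nat.one_le_pow _ _ (by norm_num)
    nlinarith
  have h2 := card_cubes_le (b := 4) (by norm_num) hd (by
    rw [Fintype.card_fin]
    have : 1 ≤ 4 ^ r := Nat.one_le_pow _ _ (by norm_num)
    nlinarith) (shatteredCubes 4 (G.image fun f => f ∘ w)) fun c hc =>
      card_support_le_of_shattersCube
        (fun S hS => hdim S (hS.mono (realClass_mono hGF))) w (mem_shatteredCubes.1 hc)
  have h3 : ((shatteredCubes 4 (G.image fun f => f ∘ w)).card : ℝ) ≤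
      ((2 ^ ((13 + 4 * r) * d) : ℕ) : ℝ) := by
    refine h2.trans ?_
    push_cast
    rw [pow_mul (2 : ℝ)]
    refine pow_le_pow_left₀ (by positivity) ?_ d
    have hd' : (0 : ℝ) < d := by exact_mod_cast hd
    have he : Real.exp 1 ≤ 4 := by linarith [Real.exp_one_lt_d9]
    rw [Fintype.card_fin, hv]
    push_cast
    calc Real.exp 1 * 4 * (4 * 4 ^ r * (2 * (64 * d * 4 ^ r))) / d
        = Real.exp 1 * (2048 * (4 ^ r * 4 ^ r)) := by field_simp; ring
      _ ≤ 4 * (2048 * (4 ^ r * 4 ^ r)) := by gcongr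
      _ = 2 ^ (13 + 4 * r) := by
          rw [pow_add, pow_mul, ← mul_pow]; norm_num; ring
  have h4 : (shatteredCubes 4 (G.image fun f => f ∘ w)).card ≤ 2 ^ ((13 + 4 * r) * d) := by
    exact_mod_cast h3
  have h5 : 2 ^ v ≤ 2 ^ ((13 + 4 * r) * d * (r + 3)) := by
    rw [pow_mul 2 _ (r + 3)]
    exact h1.trans (Nat.pow_le_pow_left h4 _)
  have h6 := (Nat.pow_le_pow_iff_right (by norm_num)).1 h5
  have h7 := Nat.mul_lt_mul_of_pos_left (quadratic_lt_pow_four r) (by omega : 0 < d)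
  nlinarith

/-- Maximal separated subsets are nets. -/
theorem exists_separated_net {α : Type*} (R : α → α → Prop) (hsymm : ∀ x y, R x y → R y x)
    (hirr : ∀ x, ¬ R x x) (F : Finset α) :
    ∃ N ⊆ F, (∀ x ∈ N, ∀ y ∈ N, x ≠ y → R x y) ∧ ∀ x ∈ F, ∃ y ∈ N, ¬ R x y := by
  classical
  induction F using Finset.induction_on with
  | empty => exact ⟨∅, by simp⟩
  | insert a F ha ih =>
    obtain ⟨N, hN, hsep, hnet⟩ := ih
    by_cases h : ∃ y ∈ N, ¬ R a y
    · refine ⟨N, hN.trans (Finset.subset_insert _ _), hsep, fun x hx => ?_⟩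
      rcases Finset.mem_insert.1 hx with rfl | hx
      · exact h
      · exact hnet x hx
    · push Not at h
      refine ⟨insert a N, Finset.insert_subset_insert _ hN, fun x hx y hy hne => ?_, fun x hx => ?_⟩
      · rcases Finset.mem_insert.1 hx with hx | hx <;> rcases Finset.mem_insert.1 hy with hy | hy
        · exact absurd (hx.trans hy.symm) hne
        · exact hx ▸ h y hy
        · exact hsymm _ _ (hy ▸ h x hx)
        · exact hsep x hx y hy hne
      · rcases Finset.mem_insert.1 hx with rfl | hx
        · exact ⟨x, Finset.mem_insert_self _ _, hirr x⟩
        · obtain ⟨y, hy, hxy⟩ := hnet x hx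
          exact ⟨y, Finset.mem_insert_of_mem hy, hxy⟩

end Packing

/-! ### Hoeffding's inequality for random signs -/

section Signs

/-- Hoeffding's inequality for random signs, in counting form. -/
theorem card_signs_ge_le {m : ℕ} (a : Fin m → ℝ) {V t : ℝ} (hV : ∑ i, a i ^ 2 ≤ V) (hV0 : 0 < V)
    (ht : 0 ≤ t) :
    ((Finset.univ.filter fun σ : Fin m → Bool => t ≤ ∑ i, if σ i then a i else -a i).card : ℝ) ≤
      2 ^ m * Real.exp (-t ^ 2 / (2 * V)) := by
  classical
  -- The Chernoff parameter minimizing x²V/2 - xt.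
  set x := t / V with hx
  have hx0 : 0 ≤ x := by positivity
  have hgen : ∑ σ : Fin m → Bool, Real.exp (x * ∑ i, if σ i then a i else -a i) ≤
      2 ^ m * Real.exp (x ^ 2 * V / 2) := by
    have h1 := Finset.prod_univ_sum (fun _ : Fin m => (Finset.univ : Finset Bool))
      (fun i s => Real.exp (x * if s then a i else -a i))
    rw [Fintype.piFinset_univ] at h1
    have h2 : ∀ σ : Fin m → Bool, Real.exp (x * ∑ i, if σ i then a i else -a i) =
        ∏ i, Real.exp (x * if σ i then a i else -a i) := fun σ => by
      rw [Finset.mul_sum, Real.exp_sum]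
    simp only [h2]
    rw [← h1]
    calc ∏ i, ∑ s : Bool, Real.exp (x * if s then a i else -a i)
        ≤ ∏ i, (2 * Real.exp ((x * a i) ^ 2 / 2)) := by
          refine Finset.prod_le_prod (fun i _ => by positivity) fun i _ => ?_
          have := Real.cosh_le_exp_half_sq (x * a i)
          rw [Real.cosh_eq] at this
          simp only [Fintype.sum_bool, if_true, Bool.false_eq_true, if_false, mul_neg]
          linarith
      _ = 2 ^ m * Real.exp (∑ i, (x * a i) ^ 2 / 2) := by
          rw [Finset.prod_mul_distrib, Real.exp_sum]; simp
      _ ≤ _ := by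
          gcongr
          rw [← Finset.sum_div]
          gcongr
          simp only [mul_pow]
          rw [← Finset.mul_sum]
          gcongr
  set A := Finset.univ.filter fun σ : Fin m → Bool => t ≤ ∑ i, if σ i then a i else -a i
  have hlow : (A.card : ℝ) * Real.exp (x * t) ≤
      ∑ σ : Fin m → Bool, Real.exp (x * ∑ i, if σ i then a i else -a i) := by
    calc (A.card : ℝ) * Real.exp (x * t) = ∑ _σ ∈ A, Real.exp (x * t) := by simp
      _ ≤ ∑ σ ∈ A, Real.exp (x * ∑ i, if σ i then a i else -a i) := by
          refine Finset.sum_le_sum fun σ hσ => ?_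
          have := (Finset.mem_filter.1 hσ).2
          gcongr
      _ ≤ _ := Finset.sum_le_sum_of_subset_of_nonneg (Finset.subset_univ _)
          fun _ _ _ => (Real.exp_pos _).le
  have h3 := hlow.trans hgen
  rw [← le_div_iff₀ (Real.exp_pos _), mul_div_assoc, ← Real.exp_sub] at h3
  refine h3.trans (le_of_eq ?_)
  congr 2
  rw [hx]; field_simp; ring

end Signs

/-! ### Two-step chaining on the double sample -/

section Swaps

/-- Chaining with two steps: the number of swap patterns for which some member of the class is
small (`= 0`) on one half of a double sample much more often than it is moderate (`≤ 4`) on the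
other half. -/
theorem card_bad_swaps_le {m d r : ℕ} (hd : 1 ≤ d) (hdm : d ≤ m) (hm : m ≤ 2 ^ 4 ^ r)
    (F : Finset (Fin m × Bool → ℕ)) (hb : ∀ f ∈ F, ∀ i, f i ≤ 5)
    (hdim : ∀ S : Finset (Fin m × Bool), FatShatters 1 (realClass F) S → S.card ≤ d)
    {a : ℝ} (ha : 0 ≤ a) (A : Finset (Fin m → Bool))
    (hA : ∀ σ ∈ A, ∃ f ∈ F, a < ∑ i, ((if f (i, !σ i) = 0 then (1 : ℝ) else 0) -
      if f (i, σ i) ≤ 4 then 1 else 0)) :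
    (A.card : ℝ) ≤ 2 ^ m * (2 ^ (64 * d * 4 ^ r) * Real.exp (-a ^ 2 / (8 * m)) +
      2 ^ (18 * (4 ^ r) ^ 2 * d) * Real.exp (-a ^ 2 * 4 ^ r / (32 * m))) := by
  classical
  have hm0 : (0 : ℝ) < m := by exact_mod_cast (by omega : 0 < m)
  have hcard : Fintype.card (Fin m × Bool) = 2 * m := by simp [mul_comm]
  -- `N₂` is the fine net, within one level everywhere; `N₁` below is the coarse one, within one
  -- level off a fraction 4^(-r) of the points.
  obtain ⟨N₂, hN₂F, hN₂sep, hN₂net⟩ := exists_separated_net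
    (fun f g : Fin m × Bool → ℕ => 1 ≤ (sepCoords f g).card)
    (fun f g h => by rwa [sepCoords_comm]) (fun f => by simp [sepCoords_self]) F
  obtain ⟨N₁, hN₁F, hN₁sep, hN₁net⟩ := exists_separated_net
    (fun f g : Fin m × Bool → ℕ => Fintype.card (Fin m × Bool) ≤ 4 ^ r * (sepCoords f g).card)
    (fun f g h => by rwa [sepCoords_comm])
    (fun f => by rw [sepCoords_self, hcard]; simp; omega) F
  have hc₂ : N₂.card ≤ 2 ^ (18 * (4 ^ r) ^ 2 * d) :=
    card_le_of_separated (Nat.one_le_pow _ _ (by norm_num)) hd N₂ (fun f hf => hb f (hN₂F hf))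
      (fun S hS => hdim S (hS.mono (realClass_mono hN₂F))) (by omega)
      (by rw [hcard, pow_succ]; omega) hN₂sep
  have hc₁ : N₁.card ≤ 2 ^ (64 * d * 4 ^ r) :=
    (card_lt_of_separated_fraction hd N₁ (fun f hf => hb f (hN₁F hf))
      (fun S hS => hdim S (hS.mono (realClass_mono hN₁F))) (by omega) hN₁sep).le
  have hπ : ∀ f : Fin m × Bool → ℕ, ∃ g : Fin m × Bool → ℕ, f ∈ F →
      g ∈ N₁ ∧ 4 ^ r * (sepCoords f g).card < 2 * m := by
    intro f
    by_cases hf : f ∈ F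
    · obtain ⟨g, hg, hfg⟩ := hN₁net f hf
      exact ⟨g, fun _ => ⟨hg, by rw [hcard] at hfg; omega⟩⟩
    · exact ⟨f, fun h => absurd h hf⟩
  choose π hπ using hπ
  -- `φ` is read off the coarse net at the middle level. The correction `ψ` replaces it by the fine
  -- indicator of `f x ≤ 1`, only where the two nets disagree.
  set φ : (Fin m × Bool → ℕ) → Fin m × Bool → ℝ := fun f x => if f x ≤ 2 then 1 else 0 with hφ
  set ψ : (Fin m × Bool → ℕ) → Fin m × Bool → ℝ := fun f x =>
    if x ∈ sepCoords f (π f) then (if f x ≤ 1 then 1 else 0) - φ (π f) x else 0 with hψ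
  set dev : (Fin m × Bool → ℝ) → (Fin m → Bool) → ℝ := fun u σ =>
    ∑ i, if σ i then u (i, false) - u (i, true) else -(u (i, false) - u (i, true)) with hdev
  have hdev' : ∀ u σ, dev u σ = ∑ i, (u (i, !σ i) - u (i, σ i)) := fun u σ =>
    Finset.sum_congr rfl fun i _ => by cases σ i <;> simp
  set B : (Fin m × Bool → ℝ) → Finset (Fin m → Bool) := fun u =>
    Finset.univ.filter fun σ => a / 2 ≤ dev u σ with hB
  have hsub : A ⊆ N₁.biUnion (fun f => B (φ f)) ∪ N₂.biUnion (fun f => B (ψ f)) := by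
    intro σ hσ
    obtain ⟨f, hf, hlt⟩ := hA σ hσ
    obtain ⟨g, hg, hfg⟩ := hN₂net f hf
    have hfg0 : sepCoords f g = ∅ := by
      rw [← Finset.card_eq_zero]; omega
    have hclose : ∀ x, f x < g x + 2 ∧ g x < f x + 2 := by
      intro x
      have : x ∉ sepCoords f g := by simp [hfg0]
      simp only [sepCoords, Finset.mem_filter, Finset.mem_univ, true_and] at this
      omega
    have hoff : ∀ x, x ∉ sepCoords g (π g) → g x < π g x + 2 ∧ π g x < g x + 2 := by
      intro x this
      simp only [sepCoords, Finset.mem_filter, Finset.mem_univ, true_and] at this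
      omega
    -- Each approximation shifts by at most one level. Where the nets agree, f = 0 gives g ≤ 1, then
    -- π g ≤ 2; conversely π g ≤ 2 gives g ≤ 3, then f ≤ 4. These four shifts are why the thresholds
    -- are four steps apart.
    have hle1 : ∀ x, (if f x = 0 then (1 : ℝ) else 0) ≤ φ (π g) x + ψ g x := by
      intro x
      have h1 := hclose x
      simp only [hψ, hφ]
      by_cases hx : x ∈ sepCoords g (π g)
      · rw [if_pos hx, add_sub_cancel]
        split_ifs <;> first | (exfalso; omega) | norm_num
      · have h2 := hoff x hx
        rw [if_neg hx, add_zero]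
        split_ifs <;> first | (exfalso; omega) | norm_num
    have hle2 : ∀ x, φ (π g) x + ψ g x ≤ if f x ≤ 4 then (1 : ℝ) else 0 := by
      intro x
      have h1 := hclose x
      simp only [hψ, hφ]
      by_cases hx : x ∈ sepCoords g (π g)
      · rw [if_pos hx, add_sub_cancel]
        split_ifs <;> first | (exfalso; omega) | norm_num
      · have h2 := hoff x hx
        rw [if_neg hx, add_zero]
        split_ifs <;> first | (exfalso; omega) | norm_num
    have hsum : a < dev (φ (π g)) σ + dev (ψ g) σ := by
      refine hlt.trans_le ?_
      rw [hdev', hdev', ← Finset.sum_add_distrib]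
      refine Finset.sum_le_sum fun i _ => ?_
      linarith [hle1 (i, !σ i), hle2 (i, σ i)]
    rw [Finset.mem_union, Finset.mem_biUnion, Finset.mem_biUnion]
    by_cases hcase : a / 2 ≤ dev (φ (π g)) σ
    · exact Or.inl ⟨π g, (hπ g (hN₂F hg)).1, Finset.mem_filter.2 ⟨Finset.mem_univ _, hcase⟩⟩
    · refine Or.inr ⟨g, hg, Finset.mem_filter.2 ⟨Finset.mem_univ _, ?_⟩⟩
      linarith
  have hB₁ : ∀ f, ((B (φ f)).card : ℝ) ≤ 2 ^ m * Real.exp (-a ^ 2 / (8 * m)) := by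
    intro f
    refine (card_signs_ge_le (fun i => φ f (i, false) - φ f (i, true)) (V := m) ?_ hm0
      (by positivity)).trans (le_of_eq ?_)
    · calc ∑ i, (φ f (i, false) - φ f (i, true)) ^ 2 ≤ ∑ _i : Fin m, (1 : ℝ) := by
            refine Finset.sum_le_sum fun i _ => ?_
            simp only [hφ]
            split_ifs <;> norm_num
        _ = m := by simp
    · congr 2; ring
  have hB₂ : ∀ f ∈ N₂, ((B (ψ f)).card : ℝ) ≤ 2 ^ m * Real.exp (-a ^ 2 * 4 ^ r / (32 * m)) := by
    intro f hf
    -- The support of `ψ f` has at most 2m/4^r points; this is where the variance gains the factor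
    -- 4^r.
    refine (card_signs_ge_le (fun i => ψ f (i, false) - ψ f (i, true)) (V := 4 * m / 4 ^ r) ?_
      (by positivity) (by positivity)).trans (le_of_eq ?_)
    · have hE : (4 : ℝ) ^ r * (sepCoords f (π f)).card ≤ 2 * m := by
        exact_mod_cast (hπ f (hN₂F hf)).2.le
      have hψsq : ∑ x, ψ f x ^ 2 ≤ (sepCoords f (π f)).card := by
        calc ∑ x, ψ f x ^ 2 ≤ ∑ x, (if x ∈ sepCoords f (π f) then (1 : ℝ) else 0) := by
              refine Finset.sum_le_sum fun x _ => ?_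
              simp only [hψ, hφ]
              split_ifs <;> norm_num
          _ = _ := by simp
      calc ∑ i, (ψ f (i, false) - ψ f (i, true)) ^ 2
          ≤ ∑ i, 2 * (ψ f (i, true) ^ 2 + ψ f (i, false) ^ 2) := by
            refine Finset.sum_le_sum fun i _ => ?_
            nlinarith [sq_nonneg (ψ f (i, false) + ψ f (i, true))]
        _ = 2 * ∑ x, ψ f x ^ 2 := by
            rw [← Finset.mul_sum, Fintype.sum_prod_type]
            simp
        _ ≤ 2 * (sepCoords f (π f)).card := by gcongr
        _ ≤ 4 * m / 4 ^ r := by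
            rw [le_div_iff₀ (by positivity)]
            linarith
    · congr 2; field_simp; ring
  have hcA : (A.card : ℝ) ≤ ∑ f ∈ N₁, ((B (φ f)).card : ℝ) + ∑ f ∈ N₂, ((B (ψ f)).card : ℝ) := by
    have := (Finset.card_le_card hsub).trans (Finset.card_union_le _ _)
    have := this.trans (Nat.add_le_add Finset.card_biUnion_le Finset.card_biUnion_le)
    exact_mod_cast this
  have hc₁' : (N₁.card : ℝ) ≤ 2 ^ (64 * d * 4 ^ r) := by exact_mod_cast hc₁
  have hc₂' : (N₂.card : ℝ) ≤ 2 ^ (18 * (4 ^ r) ^ 2 * d) := by exact_mod_cast hc₂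
  have hs₁ := Finset.sum_le_card_nsmul N₁ (fun f => ((B (φ f)).card : ℝ)) _ fun f _ => hB₁ f
  have hs₂ := Finset.sum_le_card_nsmul N₂ (fun f => ((B (ψ f)).card : ℝ)) _ hB₂
  rw [nsmul_eq_mul] at hs₁ hs₂
  calc (A.card : ℝ) ≤ N₁.card * (2 ^ m * Real.exp (-a ^ 2 / (8 * m))) +
        N₂.card * (2 ^ m * Real.exp (-a ^ 2 * 4 ^ r / (32 * m))) := by linarith
    _ ≤ 2 ^ (64 * d * 4 ^ r) * (2 ^ m * Real.exp (-a ^ 2 / (8 * m))) +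
        2 ^ (18 * (4 ^ r) ^ 2 * d) * (2 ^ m * Real.exp (-a ^ 2 * 4 ^ r / (32 * m))) := by gcongr
    _ = _ := by ring

end Swaps

/-! ### Quantization at five equally spaced thresholds -/

section Quantization

/-- Position of `u` relative to the thresholds `t, t + s, …, t + 4 s`. -/
noncomputable def quant (t s u : ℝ) : ℕ := min 5 ⌊(u - t) / s + 1⌋₊

theorem quant_le_five (t s u : ℝ) : quant t s u ≤ 5 := min_le_left _ _

theorem le_quant_iff {t s u : ℝ} (hs : 0 < s) {k : ℕ} (hk : k < 5) :
    k + 1 ≤ quant t s u ↔ t + k * s ≤ u := by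
  rw [quant, le_min_iff, and_iff_right (by omega : k + 1 ≤ 5), Nat.le_floor_iff' (by omega)]
  push_cast
  rw [add_le_add_iff_right, le_div_iff₀ hs]
  constructor <;> intro h <;> linarith

theorem quant_le_iff {t s u : ℝ} (hs : 0 < s) {k : ℕ} (hk : k < 5) :
    quant t s u ≤ k ↔ u < t + k * s := by
  rw [← not_le, ← le_quant_iff hs hk]
  omega

theorem quant_eq_zero_iff {t s u : ℝ} (hs : 0 < s) : quant t s u = 0 ↔ u < t := by
  rw [← Nat.le_zero, quant_le_iff hs (by norm_num)]
  simp

end Quantization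

/-! ### Symmetrization and the uniform deviation bound -/

section Symmetrization

variable {Z ι : Type*}

/-- Quantization does not increase the fat-shattering dimension. -/
theorem card_le_of_fatShatters_quant {J : Type*} {g : ι → Z → ℝ} {t s : ℝ} (hs : 0 < s) {d : ℕ}
    (hdim : ∀ S : Finset Z, FatShatters (s / 2) (Set.range g) S → S.card ≤ d) (z : J → Z)
    (F : Finset (J → ℕ)) (hF : ∀ f ∈ F, ∃ j, f = fun x => quant t s (g j (z x)))
    (S : Finset J) (hS : FatShatters 1 (realClass F) S) : S.card ≤ d := by
  obtain ⟨r, hr⟩ := hS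
  refine card_le_of_shattered_family (by positivity) hdim z S
    -- With k the integer part of r - 1, the low side lies below t + ks and the high side above t +
    -- (k+1)s; the witness is their midpoint.
    (fun x => t + ((⌊r x - 1⌋₊ : ℝ) + 1 / 2) * s) fun T => ?_
  classical
  have hr' : ∀ T : Set J, ∃ f ∈ F, ∀ x ∈ S, (x ∈ T → r x + 1 ≤ f x) ∧ (x ∉ T → (f x : ℝ) ≤ r x - 1) := by
    intro T
    obtain ⟨h, ⟨f, hf, rfl⟩, hT⟩ := hr (S.filter fun x => x ∈ T) (Finset.filter_subset _ _)
    refine ⟨f, hf, fun x hx => ⟨fun hxT => (hT x hx).1 ?_, fun hxT => (hT x hx).2 ?_⟩⟩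
    · exact Finset.mem_filter.2 ⟨hx, hxT⟩
    · exact fun h => hxT (Finset.mem_filter.1 h).2
  have hr1 : ∀ x ∈ S, 0 ≤ r x - 1 := fun x hx => by
    obtain ⟨f, -, hf⟩ := hr' ∅
    exact le_trans (Nat.cast_nonneg _) ((hf x hx).2 (by simp))
  have hr2 : ∀ x ∈ S, ⌊r x - 1⌋₊ ≤ 3 := fun x hx => by
    obtain ⟨f, hf, hf'⟩ := hr' Set.univ
    obtain ⟨j, rfl⟩ := hF f hf
    have h1 := (hf' x hx).1 (by simp)
    have h2 : (quant t s (g j (z x)) : ℝ) ≤ 5 := by exact_mod_cast quant_le_five _ _ _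
    have h3 := Nat.floor_le (hr1 x hx)
    have : (⌊r x - 1⌋₊ : ℝ) ≤ 3 := by linarith
    exact_mod_cast this
  obtain ⟨f, hf, hf'⟩ := hr' T
  obtain ⟨j, rfl⟩ := hF f hf
  refine ⟨g j, ⟨j, rfl⟩, fun x hx => ⟨fun hxT => ?_, fun hxT => ?_⟩⟩
  · have h1 := (hf' x hx).1 hxT
    have h3 := Nat.floor_le (hr1 x hx)
    have h4 : ((⌊r x - 1⌋₊ + 1 + 1 : ℕ) : ℝ) ≤ quant t s (g j (z x)) := by push_cast; linarith
    have h5 := (le_quant_iff hs (by have := hr2 x hx; omega)).1 (Nat.cast_le.1 h4)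
    push_cast at h5
    linarith
  · have h1 := Nat.le_floor ((hf' x hx).2 hxT)
    have h5 := (quant_le_iff hs (by have := hr2 x hx; omega)).1 h1
    linarith

open Classical in
-- Quantization leaves only finitely many patterns on a fixed double sample, so an arbitrary index
-- type reduces to a finite class.
theorem card_bad_swaps_margin_le {m d r : ℕ} (hd : 1 ≤ d) (hdm : d ≤ m) (hm : m ≤ 2 ^ 4 ^ r)
    {g : ι → Z → ℝ} {t s : ℝ} (hs : 0 < s)
    (hdim : ∀ S : Finset Z, FatShatters (s / 2) (Set.range g) S → S.card ≤ d)
    {a : ℝ} (ha : 0 ≤ a) (z : Fin m × Bool → Z) :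
    ((Finset.univ.filter fun σ : Fin m → Bool => ∃ j, a < ∑ i,
        ((if g j (z (i, !σ i)) < t then (1 : ℝ) else 0) -
          if g j (z (i, σ i)) < t + 4 * s then 1 else 0)).card : ℝ) ≤
      2 ^ m * (2 ^ (64 * d * 4 ^ r) * Real.exp (-a ^ 2 / (8 * m)) +
        2 ^ (18 * (4 ^ r) ^ 2 * d) * Real.exp (-a ^ 2 * 4 ^ r / (32 * m))) := by
  have hfin : (Set.range fun (j : ι) (x : Fin m × Bool) => quant t s (g j (z x))).Finite := by
    refine (Set.Finite.pi' (fun _ => Set.finite_Iic 5)).subset ?_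
    rintro _ ⟨j, rfl⟩ x
    exact quant_le_five _ _ _
  have hmem : ∀ f ∈ hfin.toFinset, ∃ j, f = fun x => quant t s (g j (z x)) := by
    intro f hf
    obtain ⟨j, rfl⟩ := hfin.mem_toFinset.1 hf
    exact ⟨j, rfl⟩
  refine card_bad_swaps_le hd hdm hm hfin.toFinset ?_
    (card_le_of_fatShatters_quant hs hdim z _ hmem) ha _ ?_
  · intro f hf i
    obtain ⟨j, rfl⟩ := hmem f hf
    exact quant_le_five _ _ _
  · intro σ hσ
    obtain ⟨j, hj⟩ := (Finset.mem_filter.1 hσ).2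
    refine ⟨_, hfin.mem_toFinset.2 ⟨j, rfl⟩, ?_⟩
    have h4 : ∀ u, quant t s u ≤ 4 ↔ u < t + 4 * s := fun u => by
      simpa using quant_le_iff (t := t) (u := u) hs (k := 4) (by norm_num)
    simpa only [quant_eq_zero_iff hs, h4] using hj

variable [MeasurableSpace Z] (μ : Measure Z) [IsProbabilityMeasure μ]

open Classical in
/-- The number of points of the second sample on which `g j` is below the low threshold, minus
the number of points of the first sample on which it is below the high threshold. -/
noncomputable def sampleGap {m : ℕ} (g : ι → Z → ℝ) (t s : ℝ) (j : ι)
    (S : (Fin m → Z) × (Fin m → Z)) : ℝ :=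
  ∑ i, ((if g j (S.2 i) < t then (1 : ℝ) else 0) - if g j (S.1 i) < t + 4 * s then 1 else 0)

theorem measurable_sampleGap {m : ℕ} {g : ι → Z → ℝ} (hg : ∀ j, Measurable (g j)) (t s : ℝ)
    (j : ι) : Measurable (sampleGap (m := m) g t s j) := by
  unfold sampleGap
  refine Finset.measurable_sum _ fun i _ => Measurable.sub ?_ ?_
  · exact Measurable.ite (measurableSet_lt ((hg j).comp (by fun_prop)) measurable_const)
      measurable_const measurable_const
  · exact Measurable.ite (measurableSet_lt ((hg j).comp (by fun_prop)) measurable_const)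
      measurable_const measurable_const

theorem measurableSet_exists_lt_sampleGap [Countable ι] {m : ℕ} {g : ι → Z → ℝ}
    (hg : ∀ j, Measurable (g j)) (t s a : ℝ) :
    MeasurableSet {S : (Fin m → Z) × (Fin m → Z) | ∃ j, a < sampleGap g t s j S} := by
  rw [Set.ofPred_exists]
  exact MeasurableSet.iUnion fun j =>
    measurableSet_lt measurable_const (measurable_sampleGap hg t s j)

/-- Exchanging the two samples at the coordinates where `σ` is true. -/
def swapSamples {m : ℕ} (σ : Fin m → Bool) (W : Fin m → Z × Z) : Fin m → Z × Z :=
  fun i => (if σ i then Prod.swap else id) (W i)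

theorem measurePreserving_swapSamples {m : ℕ} (σ : Fin m → Bool) :
    MeasurePreserving (swapSamples σ) (Measure.pi fun _ : Fin m => μ.prod μ)
      (Measure.pi fun _ : Fin m => μ.prod μ) := by
  refine measurePreserving_pi (fun _ => μ.prod μ) (fun _ => μ.prod μ) (fun i => ?_)
  cases σ i
  · simpa using MeasurePreserving.id _
  · simpa using Measure.measurePreserving_swap

/-- Symmetrization by random swaps. -/
theorem measure_exists_lt_sampleGap_le [Countable ι] {m d r : ℕ} (hd : 1 ≤ d) (hdm : d ≤ m)
    (hm : m ≤ 2 ^ 4 ^ r) {g : ι → Z → ℝ} (hg : ∀ j, Measurable (g j)) {t s : ℝ} (hs : 0 < s)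
    (hdim : ∀ S : Finset Z, FatShatters (s / 2) (Set.range g) S → S.card ≤ d)
    {a : ℝ} (ha : 0 ≤ a) :
    ((Measure.pi fun _ : Fin m => μ).prod (Measure.pi fun _ : Fin m => μ))
        {S | ∃ j, a < sampleGap g t s j S} ≤
      ENNReal.ofReal (2 ^ (64 * d * 4 ^ r) * Real.exp (-a ^ 2 / (8 * m)) +
        2 ^ (18 * (4 ^ r) ^ 2 * d) * Real.exp (-a ^ 2 * 4 ^ r / (32 * m))) := by
  classical
  set bd := 2 ^ (64 * d * 4 ^ r) * Real.exp (-a ^ 2 / (8 * m)) +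
        2 ^ (18 * (4 ^ r) ^ 2 * d) * Real.exp (-a ^ 2 * 4 ^ r / (32 * m)) with hbd
  set P := Measure.pi fun _ : Fin m => μ.prod μ with hP
  have he := measurePreserving_arrowProdEquivProdArrow Z Z (Fin m) (fun _ => μ) (fun _ => μ)
  set A := {S : (Fin m → Z) × (Fin m → Z) | ∃ j, a < sampleGap g t s j S} with hA
  have hAm : MeasurableSet A := measurableSet_exists_lt_sampleGap hg t s a
  rw [← he.measure_preimage hAm.nullMeasurableSet]
  set A' := (MeasurableEquiv.arrowProdEquivProdArrow Z Z (Fin m)) ⁻¹' A with hA'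
  have hA'm : MeasurableSet A' := he.measurable hAm
  have hsw : ∀ σ : Fin m → Bool, P (swapSamples σ ⁻¹' A') = P A' := fun σ =>
    (measurePreserving_swapSamples μ σ).measure_preimage hA'm.nullMeasurableSet
  have hswm : ∀ σ : Fin m → Bool, MeasurableSet (swapSamples σ ⁻¹' A') := fun σ =>
    (measurePreserving_swapSamples μ σ).measurable hA'm
  -- The law of the double sample is invariant under every swap, so it is enough to average over
  -- swaps for each fixed `W`.
  have hpt : ∀ W : Fin m → Z × Z,
      ∑ σ : Fin m → Bool, (swapSamples σ ⁻¹' A').indicator (1 : (Fin m → Z × Z) → ℝ≥0∞) W ≤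
        ENNReal.ofReal (2 ^ m * bd) := by
    intro W
    have h := card_bad_swaps_margin_le hd hdm hm (t := t) hs hdim ha
      (fun x : Fin m × Bool => if x.2 then (W x.1).2 else (W x.1).1)
    refine le_trans (le_of_eq ?_) (ENNReal.ofReal_le_ofReal h)
    rw [ENNReal.ofReal_natCast, Finset.card_filter, Nat.cast_sum]
    refine Finset.sum_congr rfl fun σ _ => ?_
    rw [Set.indicator_apply]
    have hiff : W ∈ swapSamples σ ⁻¹' A' ↔ ∃ j, a < ∑ i,
        ((if g j (if (!σ i) = true then (W i).2 else (W i).1) < t then (1 : ℝ) else 0) -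
          if g j (if σ i = true then (W i).2 else (W i).1) < t + 4 * s then 1 else 0) := by
      have hsum : ∀ j, sampleGap g t s j
          (MeasurableEquiv.arrowProdEquivProdArrow Z Z (Fin m) (swapSamples σ W)) = ∑ i,
          ((if g j (if (!σ i) = true then (W i).2 else (W i).1) < t then (1 : ℝ) else 0) -
          if g j (if σ i = true then (W i).2 else (W i).1) < t + 4 * s then 1 else 0) := by
        intro j
        unfold sampleGap
        refine Finset.sum_congr rfl fun i _ => ?_
        have h1 : (MeasurableEquiv.arrowProdEquivProdArrow Z Z (Fin m) (swapSamples σ W)).2 i =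
            (swapSamples σ W i).2 := rfl
        have h2 : (MeasurableEquiv.arrowProdEquivProdArrow Z Z (Fin m) (swapSamples σ W)).1 i =
            (swapSamples σ W i).1 := rfl
        rw [h1, h2]
        simp only [swapSamples]
        rcases Bool.eq_false_or_eq_true (σ i) with h | h <;> simp [h]
      simp only [← hsum]
      rfl
    by_cases hW : W ∈ swapSamples σ ⁻¹' A'
    · rw [if_pos hW, if_pos (hiff.1 hW)]; simp
    · rw [if_neg hW, if_neg (fun h => hW (hiff.2 h))]; simp
  have hsum : (2 : ℝ≥0∞) ^ m * P A' ≤ 2 ^ m * ENNReal.ofReal bd := by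
    calc (2 : ℝ≥0∞) ^ m * P A' = ∑ σ : Fin m → Bool, P (swapSamples σ ⁻¹' A') := by
          simp [hsw]
      _ = ∑ σ : Fin m → Bool, ∫⁻ W, (swapSamples σ ⁻¹' A').indicator 1 W ∂P :=
          Finset.sum_congr rfl fun σ _ => (lintegral_indicator_one (hswm σ)).symm
      _ = ∫⁻ W, ∑ σ : Fin m → Bool, (swapSamples σ ⁻¹' A').indicator 1 W ∂P :=
          (lintegral_finsetSum _ fun σ _ => measurable_one.indicator (hswm σ)).symm
      _ ≤ ∫⁻ _W, ENNReal.ofReal (2 ^ m * bd) ∂P := lintegral_mono hpt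
      _ = ENNReal.ofReal (2 ^ m * bd) := by simp
      _ = _ := by
          rw [ENNReal.ofReal_mul (by positivity), ENNReal.ofReal_pow (by norm_num)]
          simp
  exact (ENNReal.mul_le_mul_iff_right (by simp) (by simp)).1 hsum

open Classical in
/-- Chebyshev's inequality for the number of sample points in a set. -/
theorem measure_sample_count_ge {m : ℕ} (hm : 0 < m) {E : Set Z} (hE : MeasurableSet E) {ε : ℝ}
    (hε : 0 < ε) (hmε : 2 ≤ m * ε ^ 2) :
    1 / 2 ≤ (Measure.pi fun _ : Fin m => μ)
      {S | m * μ.real E - m * ε / 2 < ∑ i, if S i ∈ E then (1 : ℝ) else 0} := by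
  set P := Measure.pi fun _ : Fin m => μ with hP
  set X : Fin m → Z → ℝ := fun _ => E.indicator 1 with hX
  have hXm : Measurable (E.indicator (1 : Z → ℝ)) := measurable_one.indicator hE
  have hbound : ∀ x, E.indicator (1 : Z → ℝ) x ∈ Set.Icc (0 : ℝ) 1 := fun x => by
    by_cases hx : x ∈ E <;> simp [hx]
  have hXL : ∀ i, MemLp (X i) 2 μ := fun i =>
    MemLp.of_bound hXm.aestronglyMeasurable 1 (Filter.Eventually.of_forall fun x => by
      rw [Real.norm_eq_abs, abs_of_nonneg (hbound x).1]; exact (hbound x).2)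
  set Y : (Fin m → Z) → ℝ := ∑ i, fun S => X i (S i) with hY
  have hYL : MemLp Y 2 P :=
    memLp_finsetSum' _ fun i _ => (hXL i).comp_measurePreserving (measurePreserving_eval _ i)
  have hvar : ProbabilityTheory.variance Y P ≤ m / 4 := by
    rw [hY, hP, ProbabilityTheory.variance_sum_pi hXL]
    calc ∑ i, ProbabilityTheory.variance (X i) μ ≤ ∑ _i : Fin m, (1 / 4 : ℝ) := by
          refine Finset.sum_le_sum fun i _ => ?_
          have := ProbabilityTheory.variance_le_sq_of_bounded (μ := μ) (X := X i)
            (Filter.Eventually.of_forall hbound) hXm.aemeasurable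
          norm_num at this ⊢
          exact this
      _ = m / 4 := by simp; ring
  have hmean : ∫ S, Y S ∂P = m * μ.real E := by
    have : ∀ S, Y S = ∑ i, X i (S i) := fun S => by simp [hY]
    simp only [this]
    rw [integral_finsetSum]
    · have : ∀ i, ∫ S, X i (S i) ∂P = μ.real E := fun i => by
        rw [integral_comp_eval (μ := fun _ : Fin m => μ) (f := X i) hXm.aestronglyMeasurable]
        simp only [hX]
        rw [integral_indicator_one hE]
      simp [this]
    · intro i _
      exact ((hXL i).comp_measurePreserving (measurePreserving_eval _ i)).integrable (by norm_num)
  have hm0 : (0 : ℝ) < m := by exact_mod_cast hm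
  have hcheb := ProbabilityTheory.meas_ge_le_variance_div_sq hYL (c := m * ε / 2) (by positivity)
  have hle : ProbabilityTheory.variance Y P / (m * ε / 2) ^ 2 ≤ 1 / 2 := by
    rw [div_le_iff₀ (by positivity)]
    nlinarith
  have hcompl : {S | m * μ.real E - m * ε / 2 < ∑ i, if S i ∈ E then (1 : ℝ) else 0}ᶜ ⊆
      {S | m * ε / 2 ≤ |Y S - ∫ S, Y S ∂P|} := by
    intro S hS
    have h1 : Y S = ∑ i, if S i ∈ E then (1 : ℝ) else 0 := by
      simp [hY, hX, Set.indicator_apply]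
    simp only [Set.mem_compl_iff, Set.mem_ofPred_eq, not_lt] at hS ⊢
    rw [hmean, h1]
    refine le_trans ?_ (neg_le_abs _)
    linarith
  have hmeas : MeasurableSet
      {S : Fin m → Z | m * μ.real E - m * ε / 2 < ∑ i, if S i ∈ E then (1 : ℝ) else 0} := by
    refine measurableSet_lt measurable_const (Finset.measurable_sum _ fun i _ => ?_)
    exact Measurable.ite (measurable_pi_apply i hE) measurable_const measurable_const
  have hhalf : P {S | m * μ.real E - m * ε / 2 < ∑ i, if S i ∈ E then (1 : ℝ) else 0}ᶜ ≤ 1 / 2 := by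
    refine (measure_mono hcompl).trans (hcheb.trans ?_)
    refine (ENNReal.ofReal_le_ofReal hle).trans (le_of_eq ?_)
    rw [ENNReal.ofReal_div_of_pos (by norm_num)]
    simp
  rw [prob_compl_eq_one_sub hmeas] at hhalf
  rw [tsub_le_iff_right] at hhalf
  have h2 : (1 : ℝ≥0∞) / 2 + 1 / 2 ≤ 1 / 2 + P {S | m * μ.real E - m * ε / 2 <
      ∑ i, if S i ∈ E then (1 : ℝ) else 0} := by
    rwa [ENNReal.add_halves]
  exact (ENNReal.add_le_add_iff_left (by simp)).1 h2

open Classical in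
/-- Uniform one-sided deviation bound at two thresholds, for a countable class whose
fat-shattering dimension at one eighth of the gap is `d`. -/
theorem measure_exists_lt_sub_le [Countable ι] {m d r : ℕ} (hd : 1 ≤ d) (hdm : d ≤ m)
    (hm : m ≤ 2 ^ 4 ^ r) {g : ι → Z → ℝ} (hg : ∀ j, Measurable (g j)) {t s : ℝ} (hs : 0 < s)
    (hdim : ∀ S : Finset Z, FatShatters (s / 2) (Set.range g) S → S.card ≤ d)
    {ε δ : ℝ} (hε : 0 < ε) (hδ : 0 < δ) (hδ1 : δ ≤ 1)
    (hmε : 2560 * (d * 4 ^ r + Real.log (1 / δ)) ≤ m * ε ^ 2) :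
    (Measure.pi fun _ : Fin m => μ) {S | ∃ j, ε < μ.real {z | g j z < t} -
        1 / (m : ℝ) * ∑ i, if g j (S i) < t + 4 * s then (1 : ℝ) else 0} ≤ ENNReal.ofReal δ := by
  set P := Measure.pi fun _ : Fin m => μ with hP
  have hm1 : 0 < m := by omega
  have hm0 : (0 : ℝ) < m := by exact_mod_cast hm1
  set l : ℝ := 4 ^ r with hl
  have hl1 : 1 ≤ l := one_le_pow₀ (by norm_num)
  have hd1 : (1 : ℝ) ≤ d := by exact_mod_cast hd
  have hdl : 1 ≤ d * l := by nlinarith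
  set y := Real.log (1 / δ) with hy
  have hy0 : 0 ≤ y := Real.log_nonneg (by rw [le_div_iff₀ hδ]; linarith)
  set bd := 2 ^ (64 * d * 4 ^ r) * Real.exp (-(m * ε / 2) ^ 2 / (8 * m)) +
        2 ^ (18 * (4 ^ r) ^ 2 * d) * Real.exp (-(m * ε / 2) ^ 2 * 4 ^ r / (32 * m)) with hbd
  have hgap := measure_exists_lt_sampleGap_le μ hd hdm hm hg (t := t) hs hdim (a := m * ε / 2)
    (by positivity)
  have hAm := measurableSet_exists_lt_sampleGap (m := m) hg t s (m * ε / 2)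
  set A := {S : (Fin m → Z) × (Fin m → Z) | ∃ j, m * ε / 2 < sampleGap g t s j S} with hA
  -- For a bad first sample, fix one bad `j`: an independent second sample has frequency within ε/2
  -- of the true probability from below with chance at least 1/2, leaving a gap above mε/2 between
  -- the samples.
  have hghost : {S | ∃ j, ε < μ.real {z | g j z < t} -
        1 / (m : ℝ) * ∑ i, if g j (S i) < t + 4 * s then (1 : ℝ) else 0} ⊆
      {S | 1 / 2 ≤ P (Prod.mk S ⁻¹' A)} := by
    rintro S ⟨j, hj⟩
    have hE : MeasurableSet {z | g j z < t} := measurableSet_lt (hg j) measurable_const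
    refine (measure_sample_count_ge μ hm1 hE hε (by nlinarith)).trans (measure_mono ?_)
    intro S' hS'
    refine ⟨j, ?_⟩
    simp only [Set.mem_ofPred_eq] at hS'
    simp only [sampleGap, Finset.sum_sub_distrib]
    have h1 : m * ε < m * μ.real {z | g j z < t} -
        ∑ i, if g j (S i) < t + 4 * s then (1 : ℝ) else 0 := by
      have := mul_lt_mul_of_pos_left hj hm0
      rw [mul_sub, ← mul_assoc, mul_one_div_cancel hm0.ne', one_mul] at this
      exact this
    linarith
  have hmarkov : (1 / 2 : ℝ≥0∞) * P {S | 1 / 2 ≤ P (Prod.mk S ⁻¹' A)} ≤ (P.prod P) A := by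
    rw [Measure.prod_apply hAm]
    exact mul_meas_ge_le_lintegral (measurable_measure_prodMk_left hAm) _
  -- The constant 2560 leaves 80 against 64 in the coarse exponent and 20 against 18 in the fine
  -- one, enough for a factor δ/4 in each.
  have hbdδ : 2 * bd ≤ δ := by
    have hexp2 : Real.exp (-2) ≤ 1 / 4 := by
      rw [show (-2 : ℝ) = -1 + -1 by norm_num, Real.exp_add]
      have h1 : Real.exp (-1) ≤ 1 / 2 := by
        rw [Real.exp_neg, one_div]
        have := Real.add_one_le_exp (1 : ℝ)
        gcongr
        linarith
      have := Real.exp_pos (-1)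
      nlinarith
    have hδe : Real.exp (-y) = δ := by
      rw [hy, one_div, Real.log_inv, neg_neg, Real.exp_log hδ]
    have h2e : ∀ k : ℕ, (2 : ℝ) ^ k ≤ Real.exp k := by
      intro k
      have : (2 : ℝ) ≤ Real.exp 1 := by linarith [Real.add_one_le_exp (1 : ℝ)]
      calc (2 : ℝ) ^ k ≤ Real.exp 1 ^ k := pow_le_pow_left₀ (by norm_num) this k
        _ = Real.exp k := by rw [← Real.exp_nat_mul, mul_one]
    have key : ∀ (k : ℕ) (x : ℝ), k + x ≤ -2 - y → (2 : ℝ) ^ k * Real.exp x ≤ δ / 4 := by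
      intro k x hx
      calc (2 : ℝ) ^ k * Real.exp x ≤ Real.exp k * Real.exp x := by gcongr; exact h2e k
        _ = Real.exp (k + x) := (Real.exp_add _ _).symm
        _ ≤ Real.exp (-2 + -y) := Real.exp_le_exp.2 (by linarith)
        _ = Real.exp (-2) * δ := by rw [Real.exp_add, hδe]
        _ ≤ 1 / 4 * δ := by gcongr
        _ = δ / 4 := by ring
    have e1 : -(m * ε / 2) ^ 2 / (8 * m) = -(m * ε ^ 2 / 32) := by field_simp; ring
    have e2 : -(m * ε / 2) ^ 2 * 4 ^ r / (32 * m) = -(m * ε ^ 2 / 128 * l) := by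
      rw [← hl]; field_simp; ring
    have k1 := key (64 * d * 4 ^ r) (-(m * ε ^ 2 / 32)) (by
      push_cast
      rw [← hl]
      nlinarith)
    have k2 := key (18 * (4 ^ r) ^ 2 * d) (-(m * ε ^ 2 / 128 * l)) (by
      push_cast
      rw [← hl]
      have : 20 * (d * l + y) * l ≤ m * ε ^ 2 / 128 * l := by gcongr; linarith
      nlinarith [mul_le_mul_of_nonneg_left hl1 hy0])
    rw [hbd, e1, e2]
    linarith
  calc P _ ≤ P {S | 1 / 2 ≤ P (Prod.mk S ⁻¹' A)} := measure_mono hghost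
    _ = 2 * (1 / 2 * P {S | 1 / 2 ≤ P (Prod.mk S ⁻¹' A)}) := by
        rw [← mul_assoc, ENNReal.mul_div_cancel (by norm_num) (by norm_num), one_mul]
    _ ≤ 2 * ENNReal.ofReal bd := by gcongr; exact hmarkov.trans hgap
    _ = ENNReal.ofReal (2 * bd) := by rw [ENNReal.ofReal_mul (by norm_num)]; simp
    _ ≤ ENNReal.ofReal δ := ENNReal.ofReal_le_ofReal hbdδ

end Symmetrization

/-! ### Margins and their fat-shattering dimension -/

section Margin

theorem abs_margin_sub_margin (a b : ℝ) (y : Fin 2) : |margin a y - margin b y| = |a - b| := by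
  unfold margin
  split_ifs
  · congr 1; ring
  · rw [abs_sub_comm a b]; congr 1; ring

theorem margin_nonpos_of_half_le {a : ℝ} (ha : a ∈ Set.Icc (0 : ℝ) 1) (y : Fin 2)
    (h : 1 / 2 ≤ |a - labelVal y|) : margin a y ≤ 0 := by
  obtain ⟨h0, h1⟩ := ha
  fin_cases y
  · simp only [labelVal, Fin.zero_eta, Nat.cast_zero, sub_zero, margin] at h ⊢
    rw [abs_of_nonneg h0] at h
    rw [if_neg (by decide)]
    linarith
  · simp only [labelVal, Fin.mk_one, Nat.cast_one, margin] at h ⊢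
    rw [abs_of_nonpos (by linarith)] at h
    rw [if_pos trivial]
    linarith

theorem measurable_margin {Ω : Type*} [MeasurableSpace Ω] {f : Ω → ℝ} {y : Ω → Fin 2}
    (hf : Measurable f) (hy : Measurable y) : Measurable fun z => margin (f z) (y z) := by
  unfold margin
  exact Measurable.ite (hy (measurableSet_singleton 1)) (hf.sub_const _) (hf.const_sub _)

/-- The margins of the predictions `h (w z)` have a fat-shattering dimension at most that of the
class of predictors. -/
theorem card_le_of_fatShatters_margin {X Z : Type*} {α : ℝ} (hα : 0 < α) {H : Set (X → ℝ)} {d : ℕ}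
    (hdim : ∀ S : Finset X, FatShatters α H S → S.card ≤ d) (w : Z → X) (y : Z → Fin 2)
    {G : Set (Z → ℝ)} (hG : ∀ g ∈ G, ∃ h ∈ H, g = fun z => margin (h (w z)) (y z))
    (S : Finset Z) (hS : FatShatters α G S) : S.card ≤ d := by
  classical
  obtain ⟨r, hr⟩ := hS
  refine card_le_of_shattered_family hα hdim w S
    (fun z => if y z = 1 then r z + 1 / 2 else 1 / 2 - r z) fun T => ?_
  -- At label 0 the margin reverses order, so the pattern is complemented there.
  obtain ⟨g, hg, hT⟩ := hr (S.filter fun z => z ∈ T ↔ y z = 1) (Finset.filter_subset _ _)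
  obtain ⟨h, hh, rfl⟩ := hG g hg
  refine ⟨h, hh, fun z hz => ?_⟩
  have := hT z hz
  simp only [Finset.mem_filter, hz, true_and, margin] at this
  by_cases hy : y z = 1 <;> simp only [hy, if_true, if_false, iff_true, iff_false, not_not] at this ⊢
  · refine ⟨fun h => ?_, fun h => ?_⟩
    · linarith [this.1 h]
    · linarith [this.2 h]
  · refine ⟨fun h => ?_, fun h => ?_⟩
    · linarith [this.2 h]
    · linarith [this.1 h]

theorem card_le_of_fatDim_eq {X : Type*} {α : ℝ} {H : Set (X → ℝ)} {d : ℕ}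
    (hd : fatDim α H = (d : ℕ∞)) (S : Finset X) (hS : FatShatters α H S) : S.card ≤ d := by
  have : (S.card : ℕ∞) ≤ fatDim α H := le_iSup₂ (f := fun (S : Finset X) (_ : FatShatters α H S) =>
    (S.card : ℕ∞)) S hS
  rw [hd] at this
  exact_mod_cast this

theorem nonempty_of_fatDim_ne_zero {X : Type*} {α : ℝ} {H : Set (X → ℝ)} (h : fatDim α H ≠ 0) :
    H.Nonempty := by
  rw [Set.nonempty_iff_ne_empty]
  rintro rfl
  refine h ?_
  simp only [fatDim, ENat.iSup_eq_zero]
  rintro S ⟨r, hr⟩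
  obtain ⟨f, hf, -⟩ := hr ∅ (Finset.empty_subset _)
  exact hf.elim

end Margin

/-! ### A countable net of predictors and a finite grid of matrices -/

section Nets

/-- A class of continuous functions has a countable subclass that is dense for uniform
convergence on a compact set. -/
theorem exists_countable_uniform_net {X : Type*} [MetricSpace X] {K : Set X} (hK : IsCompact K)
    (H : Set (X → ℝ)) (hc : ∀ h ∈ H, Continuous h) {η : ℝ} (hη : 0 < η) :
    ∃ G ⊆ H, G.Countable ∧ ∀ h ∈ H, ∃ g ∈ G, ∀ x ∈ K, |h x - g x| ≤ η := by
  have : CompactSpace K := isCompact_iff_compactSpace.1 hK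
  let φ : H → C(K, ℝ) := fun h => ⟨fun x => h.1 x, (hc h.1 h.2).comp continuous_subtype_val⟩
  -- Separability of C(K, ℝ) passes to the set of restrictions of members of `H`.
  obtain ⟨s, hs, hd⟩ := TopologicalSpace.exists_countable_dense (Set.range φ)
  choose p hp using fun f : Set.range φ => f.2
  refine ⟨(fun f => (p f).1) '' s, ?_, hs.image _, fun h hh => ?_⟩
  · rintro _ ⟨f, -, rfl⟩
    exact (p f).2
  · obtain ⟨f, hf, hfs⟩ := hd.exists_dist_lt ⟨φ ⟨h, hh⟩, ⟨h, hh⟩, rfl⟩ hη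
    refine ⟨_, ⟨f, hf, rfl⟩, fun x hx => ?_⟩
    have h1 : dist (φ ⟨h, hh⟩) (φ (p f)) < η := by rw [hp f]; exact hfs
    have h2 := (ContinuousMap.dist_apply_le_dist (f := φ ⟨h, hh⟩) (g := φ (p f)) ⟨x, hx⟩).trans h1.le
    exact h2

theorem abs_apply_le_sigmaMax {D : ℕ} (M : Matrix (Fin D) (Fin D) ℝ) (i j : Fin D) :
    |M i j| ≤ sigmaMax M := by
  have h1 := (Matrix.toEuclideanCLM (n := Fin D) (𝕜 := ℝ) M).le_opNorm (EuclideanSpace.single j 1)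
  have h2 := PiLp.norm_apply_le
    (Matrix.toEuclideanCLM (n := Fin D) (𝕜 := ℝ) M (EuclideanSpace.single j 1)) i
  rw [PiLp.norm_single, norm_one, mul_one] at h1
  refine le_trans (le_of_eq ?_) (h2.trans h1)
  rw [Real.norm_eq_abs, Matrix.ofLp_toEuclideanCLM]
  simp

/-- Cauchy–Schwarz in each row: the Frobenius norm, here at most Ds, dominates the operator norm. -/
theorem norm_toEuclideanCLM_apply_le {D : ℕ} (A : Matrix (Fin D) (Fin D) ℝ) {s : ℝ} (hs : 0 ≤ s)
    (hA : ∀ i j, |A i j| ≤ s) (x : RepSpace D) :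
    ‖Matrix.toEuclideanCLM (n := Fin D) (𝕜 := ℝ) A x‖ ≤ D * s * ‖x‖ := by
  refine abs_le_of_sq_le_sq' ?_ (by positivity) |>.2
  rw [EuclideanSpace.norm_sq_eq, mul_pow, EuclideanSpace.norm_sq_eq x]
  simp only [Matrix.ofLp_toEuclideanCLM, Real.norm_eq_abs, sq_abs, Matrix.mulVec, dotProduct]
  calc ∑ i, (∑ j, A i j * x j) ^ 2 ≤ ∑ i, (∑ j, A i j ^ 2) * ∑ j, x j ^ 2 :=
        Finset.sum_le_sum fun i _ => Finset.sum_mul_sq_le_sq_mul_sq _ _ _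
    _ ≤ ∑ _i : Fin D, (∑ _j : Fin D, s ^ 2) * ∑ j, x j ^ 2 := by
        refine Finset.sum_le_sum fun i _ => mul_le_mul_of_nonneg_right
          (Finset.sum_le_sum fun j _ => ?_) (Finset.sum_nonneg fun j _ => sq_nonneg _)
        exact sq_le_sq.2 ((hA i j).trans (le_abs_self s))
    _ = (D * s) ^ 2 * ∑ j, x j ^ 2 := by simp; ring

/-- The matrices with entries in `{-1, -1 + 1/K, …, 1}`. -/
noncomputable def gridMatrix {D : ℕ} (K : ℕ) (c : Fin D × Fin D → Fin (2 * K + 1)) :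
    Matrix (Fin D) (Fin D) ℝ :=
  fun i j => ((c (i, j) : ℕ) : ℝ) / K - 1

/-- The entries of a matrix of operator norm 1 lie in [-1, 1], so each can be rounded down to the
grid. The rounded matrix need not have norm 1. -/
theorem exists_gridMatrix_near {D K : ℕ} (hK : 0 < K) {M : Matrix (Fin D) (Fin D) ℝ}
    (hM : M ∈ weightingMetrics D) :
    ∃ c : Fin D × Fin D → Fin (2 * K + 1), ∀ x : RepSpace D,
      ‖applyMetric M x - applyMetric (gridMatrix K c) x‖ ≤ D / K * ‖x‖ := by
  have hK0 : (0 : ℝ) < K := by exact_mod_cast hK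
  have hent : ∀ i j, |M i j| ≤ 1 := fun i j => (abs_apply_le_sigmaMax M i j).trans (le_of_eq hM)
  have hlt : ∀ i j, ⌊(M i j + 1) * K⌋₊ < 2 * K + 1 := fun i j => by
    have h1 := (abs_le.1 (hent i j)).2
    refine Nat.lt_succ_of_le (Nat.floor_le_of_le ?_)
    push_cast
    nlinarith
  refine ⟨fun x => ⟨⌊(M x.1 x.2 + 1) * K⌋₊, hlt x.1 x.2⟩, fun x => ?_⟩
  have hdiff : ∀ i j, |(M - gridMatrix K fun x => ⟨⌊(M x.1 x.2 + 1) * K⌋₊, hlt x.1 x.2⟩) i j| ≤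
      1 / (K : ℝ) := by
    intro i j
    have h0 : 0 ≤ (M i j + 1) * K := by
      have h1 := (abs_le.1 (hent i j)).1
      exact mul_nonneg (by linarith) hK0.le
    have h1 := Nat.floor_le h0
    have h2 := Nat.lt_floor_add_one ((M i j + 1) * K)
    simp only [Matrix.sub_apply, gridMatrix]
    rw [show M i j - ((⌊(M i j + 1) * K⌋₊ : ℝ) / K - 1) =
      ((M i j + 1) * K - ⌊(M i j + 1) * K⌋₊) / K by field_simp; ring, abs_div, abs_of_pos hK0]
    gcongr
    rw [abs_of_nonneg (by linarith)]
    linarith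
  have h := norm_toEuclideanCLM_apply_le _ (by positivity) hdiff x
  rw [map_sub] at h
  simpa [applyMetric, div_eq_mul_inv] using h

end Nets

/-! ### Union bound over the grid and choice of parameters -/

section Main

open Classical in
/-- If the deviations of the margin classes of the grid matrices are controlled on a sample in the
ball of radius `B`, then so are those of all metrics. -/
theorem classifierError_sub_le {D m K : ℕ} (hK : 0 < K) {lam : ℝ≥0} {B γ ε : ℝ} (hγ : 0 < γ)
    (hKb : lam * (D / K * B) ≤ γ / 16) {H G : Set (RepSpace D → ℝ)} (hH : H.Nonempty)
    (hGH : G ⊆ H) (hlip : ∀ h ∈ H, LipschitzWith lam h)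
    (hrange : ∀ h ∈ H, ∀ x, h x ∈ Set.Icc (0 : ℝ) 1)
    (hnet : ∀ h ∈ H, ∃ g ∈ G, ∀ x ∈ Metric.closedBall (0 : RepSpace D) B, |h x - g x| ≤ γ / 16)
    (μ : Measure (LabelledObs D)) [IsProbabilityMeasure μ] (hμ : ∀ᵐ z ∂μ, ‖z.1‖ ≤ B)
    {S : Fin m → LabelledObs D} (hS : ∀ i, ‖(S i).1‖ ≤ B)
    (hdev : ∀ c : Fin D × Fin D → Fin (2 * K + 1), ∀ g ∈ G,
      μ.real {z | margin (g (applyMetric (gridMatrix K c) z.1)) z.2 < γ / 4} -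
        1 / (m : ℝ) * ∑ i, (if margin (g (applyMetric (gridMatrix K c) (S i).1)) (S i).2 <
          γ / 4 + 4 * (γ / 8) then (1 : ℝ) else 0) ≤ ε)
    {M : Matrix (Fin D) (Fin D) ℝ} (hM : M ∈ weightingMetrics D) :
    classifierError H M μ - empiricalMarginError H γ M S ≤ ε := by
  obtain ⟨c, hc⟩ := exists_gridMatrix_near (K := K) hK hM
  have : Nonempty H := hH.to_subtype
  rw [sub_le_comm]
  -- The infimum on the empirical side is tested at an arbitrary `h`, and the same `h` is inserted
  -- in the infimum of the true error.
  refine le_ciInf fun h => ?_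
  obtain ⟨h, hh⟩ := h
  obtain ⟨g, hg, hgh⟩ := hnet h hh
  have hclose : ∀ z : LabelledObs D, ‖z.1‖ ≤ B →
      |margin (h (applyMetric M z.1)) z.2 -
        margin (g (applyMetric (gridMatrix K c) z.1)) z.2| ≤ γ / 8 := by
    intro z hz
    rw [abs_margin_sub_margin]
    -- The net is used only at M x, which stays in the ball. The grid image may leave it, but there
    -- the global Lipschitz bound for `g` suffices.
    have hMz : applyMetric M z.1 ∈ Metric.closedBall (0 : RepSpace D) B := by
      rw [mem_closedBall_zero_iff]
      have h1 := (Matrix.toEuclideanCLM (n := Fin D) (𝕜 := ℝ) M).le_opNorm z.1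
      have h2 : ‖Matrix.toEuclideanCLM (n := Fin D) (𝕜 := ℝ) M‖ = 1 := hM
      rw [h2, one_mul] at h1
      exact h1.trans hz
    have h1 := hgh _ hMz
    have h2 : |g (applyMetric M z.1) - g (applyMetric (gridMatrix K c) z.1)| ≤ γ / 16 := by
      have h3 := (hlip g (hGH hg)).dist_le_mul (applyMetric M z.1)
        (applyMetric (gridMatrix K c) z.1)
      rw [Real.dist_eq, dist_eq_norm] at h3
      refine h3.trans (le_trans ?_ hKb)
      gcongr
      refine (hc z.1).trans ?_
      gcongr
    calc _ = |(h (applyMetric M z.1) - g (applyMetric M z.1)) +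
          (g (applyMetric M z.1) - g (applyMetric (gridMatrix K c) z.1))| := by congr 1; ring
      _ ≤ _ := (abs_add_le _ _).trans (by linarith)
  have herr : classifierError H M μ ≤
      μ.real {z | margin (g (applyMetric (gridMatrix K c) z.1)) z.2 < γ / 4} := by
    refine (ciInf_le ⟨0, ?_⟩ (⟨h, hh⟩ : H)).trans ?_
    · rintro _ ⟨h', rfl⟩
      exact measureReal_nonneg
    · refine ENNReal.toReal_mono (measure_ne_top _ _) (measure_mono_ae ?_)
      filter_upwards [hμ] with z hz hz'
      have h1 := margin_nonpos_of_half_le (hrange h hh _) z.2 hz'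
      have h2 := (abs_le.1 (hclose z hz)).1
      show margin (g (applyMetric (gridMatrix K c) z.1)) z.2 < γ / 4
      linarith
  have hemp : 1 / (m : ℝ) * ∑ i, (if margin (g (applyMetric (gridMatrix K c) (S i).1)) (S i).2 <
        γ / 4 + 4 * (γ / 8) then (1 : ℝ) else 0) ≤
      1 / (m : ℝ) * ∑ i, if margin (h (applyMetric M (S i).1)) (S i).2 < γ then (1 : ℝ) else 0 := by
    gcongr with i _
    have h2 := (abs_le.1 (hclose (S i) (hS i))).2
    by_cases h3 : margin (g (applyMetric (gridMatrix K c) (S i).1)) (S i).2 < γ / 4 + 4 * (γ / 8)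
    · rw [if_pos h3, if_pos (by linarith)]
    · rw [if_neg h3]; positivity
  have := hdev c g hg
  linarith

/-- Rounding a binary logarithm up to a power of 4 costs a factor 4, and 4 / log 2 < 8. The `+ 1` in
`L` is absorbed by 2m ≤ m/γ, which also keeps the logarithm positive at m = 1. -/
theorem exists_pow_four_ge_log {m : ℕ} (hm : 1 ≤ m) {γ : ℝ} (hγ : 0 < γ) (hγ2 : γ < 1 / 2) :
    ∃ r : ℕ, m ≤ 2 ^ 4 ^ r ∧ (4 : ℝ) ^ r ≤ 8 * Real.log (m / γ) := by
  set L := Nat.log 2 m + 1 with hL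
  have hm0 : (0 : ℝ) < m := by exact_mod_cast hm
  refine ⟨Nat.clog 4 L, ?_, ?_⟩
  · exact (Nat.lt_pow_succ_log_self (by norm_num) m).le.trans
      (Nat.pow_le_pow_right (by norm_num) (Nat.le_pow_clog (by norm_num) L))
  · have h1 : 4 ^ Nat.clog 4 L ≤ 4 * L := by
      rcases Nat.lt_or_ge 1 L with h | h
      · have h2 := Nat.pow_pred_clog_lt_self (by norm_num : 1 < 4) h
        have h3 : 0 < Nat.clog 4 L := Nat.clog_pos (by norm_num) h
        calc 4 ^ Nat.clog 4 L = 4 ^ ((Nat.clog 4 L).pred + 1) := by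
              rw [← Nat.succ_eq_add_one, Nat.succ_pred_eq_of_pos h3]
          _ = 4 * 4 ^ (Nat.clog 4 L).pred := by rw [pow_succ, mul_comm]
          _ ≤ 4 * L := by omega
      · have : L = 1 := by omega
        rw [this]; simp
    have h2 : (L : ℝ) * Real.log 2 ≤ Real.log (m / γ) := by
      rw [← Real.log_pow]
      refine Real.log_le_log (by positivity) ?_
      have h3 : 2 ^ Nat.log 2 m ≤ m := Nat.pow_log_le_self 2 (by omega)
      have h4 : (2 : ℝ) ^ Nat.log 2 m ≤ m := by exact_mod_cast h3
      calc (2 : ℝ) ^ L = 2 ^ Nat.log 2 m * 2 := by rw [hL, pow_succ]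
        _ ≤ m * 2 := by gcongr
        _ ≤ m / γ := by
          rw [le_div_iff₀ hγ]
          nlinarith
    have h3 : (4 : ℝ) ^ Nat.clog 4 L ≤ 4 * L := by exact_mod_cast h1
    have h4 := Real.log_two_gt_d9
    have h5 : (0 : ℝ) ≤ L := by positivity
    nlinarith

theorem exists_grid_resolution {D : ℕ} (hD : 1 ≤ D) {lam B γ : ℝ} (hlam : 0 < lam) (hB : 0 < B)
    (hγ : 0 < γ) (hγ2 : γ < 1 / 2) :
    ∃ K : ℕ, 0 < K ∧ lam * (D / K * B) ≤ γ / 16 ∧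
      Real.log (2 * K + 1 : ℕ) ≤ 4 * Real.log (D / min (γ / 2) (1 / (2 * lam * B))) := by
  set Q := (D : ℝ) / min (γ / 2) (1 / (2 * lam * B)) with hQ
  have hD1 : (1 : ℝ) ≤ D := by exact_mod_cast hD
  have hmin : 0 < min (γ / 2) (1 / (2 * lam * B)) := lt_min (by positivity) (by positivity)
  have hQ1 : D * (2 / γ) ≤ Q := by
    calc D * (2 / γ) = D / (γ / 2) := by field_simp
      _ ≤ Q := div_le_div_of_nonneg_left (by positivity) hmin (min_le_left _ _)
  have hQ2 : D * (2 * lam * B) ≤ Q := by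
    calc D * (2 * lam * B) = D / (1 / (2 * lam * B)) := by field_simp
      _ ≤ Q := div_le_div_of_nonneg_left (by positivity) hmin (min_le_right _ _)
  have hQ4 : 4 ≤ Q := by
    refine le_trans ?_ hQ1
    have : 4 ≤ 2 / γ := by rw [le_div_iff₀ hγ]; linarith
    nlinarith
  have hx : 0 < 16 * D * lam * B / γ := by positivity
  refine ⟨⌈16 * D * lam * B / γ⌉₊, Nat.ceil_pos.2 hx, ?_, ?_⟩
  · have h1 := Nat.le_ceil (16 * D * lam * B / γ)
    have h2 : (0 : ℝ) < ⌈16 * D * lam * B / γ⌉₊ := hx.trans_le h1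
    rw [div_le_iff₀ hγ] at h1
    rw [show lam * (D / (⌈16 * D * lam * B / γ⌉₊ : ℝ) * B) =
      lam * D * B / (⌈16 * D * lam * B / γ⌉₊ : ℝ) by ring, div_le_iff₀ h2]
    linarith
  · rw [← Real.log_rpow (by linarith)]
    refine Real.log_le_log (by positivity) ?_
    have h1 := (Nat.ceil_lt_add_one hx.le).le
    have h2 : 4 * (D * lam * B / γ) ≤ Q ^ 2 := by
      calc 4 * (D * lam * B / γ) ≤ 4 * (D * lam * B / γ) * D :=
            le_mul_of_one_le_right (by positivity) hD1
        _ = (D * (2 / γ)) * (D * (2 * lam * B)) := by field_simp; norm_num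
        _ ≤ Q * Q := by gcongr
        _ = Q ^ 2 := by ring
    have h3 : 16 * D * lam * B / γ = 4 * (4 * (D * lam * B / γ)) := by ring
    push_cast
    rw [show (4 : ℝ) = (4 : ℕ) by norm_num, Real.rpow_natCast]
    -- 2K + 1 ≤ 8Q² + 3 ≤ Q⁴, because Q ≥ 4.
    nlinarith [mul_le_mul hQ4 hQ4 (by norm_num) (by linarith)]

theorem lemma3 :
    ∃ C : ℝ, 0 < C ∧
      ∀ (D : ℕ), 1 ≤ D →
      ∀ (lam : ℝ≥0), 0 < lam →
      ∀ (B : ℝ), 0 < B →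
      ∀ (H : Set (RepSpace D → ℝ)),
        (∀ h ∈ H, LipschitzWith lam h) →
        (∀ h ∈ H, ∀ x, h x ∈ Set.Icc (0 : ℝ) 1) →
      ∀ (γ : ℝ), 0 < γ → γ < 1 / 2 →
      ∀ (d : ℕ), fatDim (γ / 16) H = (d : ℕ∞) → 1 ≤ d →
      ∀ (m : ℕ), d ≤ m →
      ∀ (δ : ℝ), 0 < δ → δ < 1 →
      ∀ (μ : Measure (LabelledObs D)) [IsProbabilityMeasure μ],
        (∀ᵐ z ∂μ, ‖z.1‖ ≤ B) →
        (Measure.pi (fun _ : Fin m => μ))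
          {S | ¬ ∀ M ∈ weightingMetrics D,
            classifierError H M μ - empiricalMarginError H γ M S ≤
              C * Real.sqrt
                (1 / (m : ℝ) * Real.log (1 / δ)
                  + (D : ℝ) ^ 2 / (m : ℝ)
                      * Real.log ((D : ℝ) / min (γ / 2) (1 / (2 * (lam : ℝ) * B)))
                  + (d : ℝ) / (m : ℝ) * Real.log ((m : ℝ) / γ))}
          ≤ ENNReal.ofReal δ := by
  classical
  -- 150² = 22500 exceeds 2560 · 8, where 8 comes from 4^r ≤ 8 log(m/γ); the grid term needs only
  -- 2560 · 4.
  refine ⟨150, by norm_num, ?_⟩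
  intro D hD lam hlam B hB H hlip hrange γ hγ hγ2 d hfat hd m hdm δ hδ hδ1 μ _ hμ
  have hdim := card_le_of_fatDim_eq hfat
  have hH : H.Nonempty := nonempty_of_fatDim_ne_zero (by rw [hfat]; exact_mod_cast (by omega : d ≠ 0))
  have hm1 : 1 ≤ m := hd.trans hdm
  have hm0 : (0 : ℝ) < m := by exact_mod_cast hm1
  have hlam' : (0 : ℝ) < lam := by exact_mod_cast hlam
  obtain ⟨r, hmr, hr⟩ := exists_pow_four_ge_log hm1 hγ hγ2
  obtain ⟨K, hK, hKb, hKlog⟩ := exists_grid_resolution hD hlam' hB hγ hγ2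
  obtain ⟨G, hGH, hGc, hnet⟩ := exists_countable_uniform_net
    (isCompact_closedBall (0 : RepSpace D) B) H (fun h hh => (hlip h hh).continuous)
    (η := γ / 16) (by positivity)
  have : Countable G := hGc.to_subtype
  set Q := (D : ℝ) / min (γ / 2) (1 / (2 * (lam : ℝ) * B)) with hQ
  set X := 1 / (m : ℝ) * Real.log (1 / δ) + (D : ℝ) ^ 2 / (m : ℝ) * Real.log Q +
    (d : ℝ) / (m : ℝ) * Real.log ((m : ℝ) / γ) with hX
  set ε := 150 * Real.sqrt X with hε
  set g : (Fin D × Fin D → Fin (2 * K + 1)) → G → LabelledObs D → ℝ := fun c h z =>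
    margin (h.1 (applyMetric (gridMatrix K c) z.1)) z.2 with hg
  set N : ℝ := ((2 * K + 1 : ℕ) : ℝ) ^ (D ^ 2) with hN
  have hN1 : 1 ≤ N := one_le_pow₀ (by push_cast; linarith [(Nat.cast_nonneg K : (0 : ℝ) ≤ K)])
  have hlogδ : 0 ≤ Real.log (1 / δ) := Real.log_nonneg (by rw [le_div_iff₀ hδ]; linarith)
  have hlogK : 0 ≤ Real.log ((2 * K + 1 : ℕ) : ℝ) :=
    Real.log_nonneg (by push_cast; linarith [(Nat.cast_nonneg K : (0 : ℝ) ≤ K)])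
  have hlogQ : 0 ≤ Real.log Q := by linarith
  have hlogm : 0 < Real.log (m / γ) := by
    have : (0 : ℝ) < 4 ^ r := by positivity
    linarith
  have hd0 : (0 : ℝ) < d := by exact_mod_cast hd
  have hX0 : 0 < X := by positivity
  have hmX : m * ε ^ 2 =
      22500 * (Real.log (1 / δ) + D ^ 2 * Real.log Q + d * Real.log (m / γ)) := by
    rw [hε, mul_pow, Real.sq_sqrt hX0.le, hX]
    field_simp
    norm_num
  have hlogN : Real.log (1 / (δ / N)) = Real.log (1 / δ) + D ^ 2 * Real.log ((2 * K + 1 : ℕ) : ℝ) := by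
    rw [one_div_div, div_eq_mul_one_div, mul_comm, Real.log_mul (by positivity) (by positivity), hN,
      Real.log_pow]
    push_cast
    rfl
  have hbad : ∀ c, (Measure.pi fun _ : Fin m => μ) {S | ∃ h : G, ε < μ.real {z | g c h z < γ / 4} -
      1 / (m : ℝ) * ∑ i, if g c h (S i) < γ / 4 + 4 * (γ / 8) then (1 : ℝ) else 0} ≤
        ENNReal.ofReal (δ / N) := by
    intro c
    refine measure_exists_lt_sub_le μ hd hdm hmr (fun h => ?_) (by positivity) ?_ (by positivity)
      (by positivity) ?_ ?_
    · refine measurable_margin ?_ measurable_snd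
      have h1 : Measurable h.1 := (hlip _ (hGH h.2)).continuous.measurable
      exact h1.comp ((ContinuousLinearMap.measurable _).comp measurable_fst)
    · rw [show γ / 8 / 2 = γ / 16 by ring]
      refine card_le_of_fatShatters_margin (by positivity) hdim
        (fun z : LabelledObs D => applyMetric (gridMatrix K c) z.1) (fun z => z.2) ?_
      rintro _ ⟨h, rfl⟩
      exact ⟨h.1, hGH h.2, rfl⟩
    · rw [div_le_one (by positivity)]; linarith
    · rw [hmX, hlogN]
      have h1 : d * (4 : ℝ) ^ r ≤ d * (8 * Real.log (m / γ)) := by gcongr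
      have h2 : (D : ℝ) ^ 2 * Real.log ((2 * K + 1 : ℕ) : ℝ) ≤ D ^ 2 * (4 * Real.log Q) := by gcongr
      have h3 : 0 ≤ (D : ℝ) ^ 2 * Real.log Q := by positivity
      have h4 : 0 ≤ d * Real.log (m / γ) := by positivity
      linarith
  have hnull : (Measure.pi fun _ : Fin m => μ) {S | ¬ ∀ i, ‖(S i).1‖ ≤ B} = 0 := by
    have : ∀ᵐ S ∂(Measure.pi fun _ : Fin m => μ), ∀ i, ‖(S i).1‖ ≤ B :=
      ae_all_iff.2 fun i =>
        (measurePreserving_eval (fun _ : Fin m => μ) i).quasiMeasurePreserving.ae hμ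
    exact this
  -- Measurability of the event over all metrics is never needed: it is covered by a null set and
  -- finitely many controlled events, and outer measure is monotone.
  have hsub : {S : Fin m → LabelledObs D | ¬ ∀ M ∈ weightingMetrics D,
      classifierError H M μ - empiricalMarginError H γ M S ≤ ε} ⊆
      {S | ¬ ∀ i, ‖(S i).1‖ ≤ B} ∪ ⋃ c, {S | ∃ h : G, ε < μ.real {z | g c h z < γ / 4} -
      1 / (m : ℝ) * ∑ i, if g c h (S i) < γ / 4 + 4 * (γ / 8) then (1 : ℝ) else 0} := by
    intro S hS
    by_contra hcon
    rw [Set.mem_union, not_or, Set.mem_iUnion, not_exists] at hcon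
    refine hS fun M hM => ?_
    refine classifierError_sub_le hK hγ hKb hH hGH hlip hrange hnet μ hμ (not_not.1 hcon.1)
      (fun c h hh => ?_) hM
    by_contra hlt
    exact hcon.2 c ⟨⟨h, hh⟩, not_le.1 hlt⟩
  calc (Measure.pi fun _ : Fin m => μ) _ ≤ _ := measure_mono hsub
    _ ≤ _ := measure_union_le _ _
    _ ≤ 0 + ∑ _c : Fin D × Fin D → Fin (2 * K + 1), ENNReal.ofReal (δ / N) := by
        gcongr
        · exact hnull.le
        · exact (measure_iUnion_fintype_le _ _).trans (Finset.sum_le_sum fun c _ => hbad c)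
    _ = ENNReal.ofReal δ := by
        have hcard : (Fintype.card (Fin D × Fin D → Fin (2 * K + 1)) : ℝ) = N := by
          rw [hN]; simp [sq]
        rw [zero_add, Finset.sum_const, Finset.card_univ, ← ENNReal.ofReal_nsmul, nsmul_eq_mul,
          hcard, mul_div_cancel₀ _ (by positivity)]

end Main
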